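/- Let $N\ge 3$, let $E_1<E_2<\dots<E_N$ be real numbers, and let the Hilbert space of dimension $2N-1$ have the orthonormal basis $|n,k\rangle$, $1\le n\le N$, $1\le k\le\beta_n$, where $\beta_1=1$ and $\beta_n=2$ for $n\ge 2$. Put $$H_0=\sum_{n=1}^{N}\sum_{k=1}^{\beta_n}E_n|n,k\rangle\langle n,k|,\qquad H_I=\sum_{n=1}^{N-1}\sum_{k=1}^{\beta_n}\sum_{p=1}^{2}d_{nk,n+1\,p}\bigl(|n,k\rangle\langle n+1,p|+|n+1,p\rangle\langle n,k|\bigr)$$ with real constants $d_{nk,n+1\,p}$, let $L_0$ be the real Lie algebra generated by $iH_0$ and $iH_I$, and write $$x_{nk,ml}=i\bigl(|n,k\rangle\langle m,l|+|m,l\rangle\langle n,k|\bigr),\qquad y_{nk,ml}=|n,k\rangle\langle m,l|-|m,l\rangle\langle n,k|.$$ Assume that $$d_{n1,n+1\,1}\,d_{n2,n+1\,2}\neq d_{n1,n+1\,2}\,d_{n2,n+1\,1}\qquad(2\le n\le N-1),$$ and that $x_{11,21},x_{11,22}\in L_0$ or $y_{11,21},y_{11,22}\in L_0$. Then $\mathrm{su}(2N-1)\subseteq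 L_0$; more precisely, $L_0=\mathrm{su}(2N-1)$ if $\operatorname{tr}H_0=0$, and $L_0=\mathrm{u}(2N-1)$ if $\operatorname{tr}H_0\neq 0$. Moreover the system $H=H_0+f(t)H_I$ is completely controllable: for every $W\in \mathrm{SU}(2N-1)$ there are a time $T\ge 0$ and a bounded measurable control $f:[0,T]\to\mathbb R$ such that the solution of $i\,\dot U(t)=(H_0+f(t)H_I)U(t)$, $U(0)=1$, satisfies $U(T)=W$. If $\operatorname{tr}H_0\neq0$, this holds for every $W\in \mathrm U(2N-1)$. -/

import Mathlib

attribute [local instance] LieRing.ofAssociativeRing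

noncomputable section

namespace DegenerateSystem

/-- Degeneracy of the `n`-th level (levels are numbered from `1`): the ground state is
nondegenerate, every excited level is two-fold degenerate. -/
def deg (n : ℕ) : ℕ := if n = 1 then 1 else 2

/-- The labels `(n, k)` of the basis states `|n, k⟩`, with `1 ≤ n ≤ N` and `1 ≤ k ≤ deg n`. -/
def labels (N : ℕ) : Finset (ℕ × ℕ) :=
  (Finset.Icc 1 N ×ˢ Finset.Icc 1 2).filter fun s => s.2 ≤ deg s.1

/-- The index type of the orthonormal basis `|n, k⟩`; it has `2 N - 1` elements when `1 ≤ N`. -/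
abbrev State (N : ℕ) : Type := {s : ℕ × ℕ // s ∈ labels N}

/-- Operators on the Hilbert space of the `N`-level system, as matrices in the basis `|n, k⟩`. -/
abbrev Op (N : ℕ) : Type := Matrix (State N) (State N) ℂ

/-- The operator `|n, k⟩⟨m, l|`. -/
def ketbra (N n k m l : ℕ) : Op N :=
  Matrix.of fun a b => if a.1 = (n, k) ∧ b.1 = (m, l) then 1 else 0

/-- The free Hamiltonian `H₀ = ∑ₙ ∑ₖ Eₙ |n, k⟩⟨n, k|`. -/
def freeHamiltonian (N : ℕ) (E : ℕ → ℝ) : Op N :=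
  ∑ n ∈ Finset.Icc 1 N, ∑ k ∈ Finset.Icc 1 (deg n), (E n : ℂ) • ketbra N n k n k

/-- The dipole interaction
`H_I = ∑ₙ ∑ₖ ∑ₚ d_{nk,n+1 p} (|n, k⟩⟨n+1, p| + |n+1, p⟩⟨n, k|)`, where `d n k p` stands for the
real coupling constant `d_{nk,n+1 p}`. -/
def dipoleHamiltonian (N : ℕ) (d : ℕ → ℕ → ℕ → ℝ) : Op N :=
  ∑ n ∈ Finset.Icc 1 (N - 1), ∑ k ∈ Finset.Icc 1 (deg n), ∑ p ∈ Finset.Icc 1 2,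
    (d n k p : ℂ) • (ketbra N n k (n + 1) p + ketbra N (n + 1) p n k)

/-- `x_{nk,ml} = i (|n, k⟩⟨m, l| + |m, l⟩⟨n, k|)`. -/
def xOp (N n k m l : ℕ) : Op N :=
  Complex.I • (ketbra N n k m l + ketbra N m l n k)

/-- `y_{nk,ml} = |n, k⟩⟨m, l| - |m, l⟩⟨n, k|`. -/
def yOp (N n k m l : ℕ) : Op N :=
  ketbra N n k m l - ketbra N m l n k

/-- The real Lie algebra generated by `i H₀` and `i H_I`. -/
def dynamicalLieAlgebra (N : ℕ) (E : ℕ → ℝ) (d : ℕ → ℕ → ℕ → ℝ) : LieSubalgebra ℝ (Op N) :=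
  LieSubalgebra.lieSpan ℝ (Op N)
    {Complex.I • freeHamiltonian N E, Complex.I • dipoleHamiltonian N d}

/-- The real Lie algebra of skew-Hermitian matrices, `u(ι)`. -/
def unitaryLieAlgebra (ι : Type) [Fintype ι] [DecidableEq ι] :
    LieSubalgebra ℝ (Matrix ι ι ℂ) where
  carrier := {A | A.conjTranspose = -A}
  add_mem' := by
    intro A B hA hB
    simp only [Set.mem_ofPred_eq] at hA hB ⊢
    rw [Matrix.conjTranspose_add, hA, hB, neg_add]
  zero_mem' := by simp
  smul_mem' := by
    intro c A hA
    simp only [Set.mem_ofPred_eq] at hA ⊢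
    rw [Matrix.conjTranspose_smul, hA]
    simp
  lie_mem' := by
    intro A B hA hB
    change A.conjTranspose = -A at hA
    change B.conjTranspose = -B at hB
    change (⁅A, B⁆).conjTranspose = -⁅A, B⁆
    rw [Ring.lie_def, Matrix.conjTranspose_sub, Matrix.conjTranspose_mul,
      Matrix.conjTranspose_mul, hA, hB]
    simp

/-- The real Lie algebra of traceless skew-Hermitian matrices, `su(ι)`. -/
def specialUnitaryLieAlgebra (ι : Type) [Fintype ι] [DecidableEq ι] :
    LieSubalgebra ℝ (Matrix ι ι ℂ) where
  carrier := {A | A.conjTranspose = -A ∧ A.trace = 0}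
  add_mem' := by
    rintro A B ⟨hA, hA'⟩ ⟨hB, hB'⟩
    exact ⟨(unitaryLieAlgebra ι).add_mem hA hB, by rw [Matrix.trace_add, hA', hB', add_zero]⟩
  zero_mem' := by simp
  smul_mem' := by
    rintro c A ⟨hA, hA'⟩
    exact ⟨(unitaryLieAlgebra ι).smul_mem c hA, by rw [Matrix.trace_smul, hA', smul_zero]⟩
  lie_mem' := by
    rintro A B ⟨hA, -⟩ ⟨hB, -⟩
    refine ⟨(unitaryLieAlgebra ι).lie_mem hA hB, ?_⟩
    rw [Ring.lie_def, Matrix.trace_sub, Matrix.trace_mul_comm, sub_self]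

/-- `U` is, on `[0, T]`, the evolution operator of the Hamiltonian `H₀ + f(t) H₁` with
`U(0) = 1` (units with `ħ = 1`): the Schrödinger equation `i U'(t) = (H₀ + f(t) H₁) U(t)` in
integrated form, entry by entry. -/
def IsEvolution {ι : Type} [Fintype ι] [DecidableEq ι] (H₀ H₁ : Matrix ι ι ℂ) (f : ℝ → ℝ)
    (T : ℝ) (U : ℝ → Matrix ι ι ℂ) : Prop :=
  ContinuousOn U (Set.Icc 0 T) ∧
    ∀ t ∈ Set.Icc 0 T, ∀ a b : ι,
      U t a b = (1 : Matrix ι ι ℂ) a b +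
        ∫ s in (0 : ℝ)..t, (-Complex.I) * (((H₀ + (f s : ℂ) • H₁) * U s) a b)

/-- `W` is the evolution operator at some time `T ≥ 0` of the system `H₀ + f(t) H₁`, for some
bounded measurable control field `f`. -/
def Reachable {ι : Type} [Fintype ι] [DecidableEq ι] (H₀ H₁ W : Matrix ι ι ℂ) : Prop :=
  ∃ T : ℝ, 0 ≤ T ∧ ∃ f : ℝ → ℝ, Measurable f ∧ (∃ C : ℝ, ∀ t, |f t| ≤ C) ∧
    ∃ U : ℝ → Matrix ι ι ℂ, IsEvolution H₀ H₁ f T U ∧ U T = W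

/-- Complete controllability of the system `H₀ + f(t) H₁`: every special unitary operator is
reached exactly. Since every unitary operator is a phase times a special unitary one, every
unitary operator is then reached up to the physically irrelevant global phase. -/
def CompletelyControllable {ι : Type} [Fintype ι] [DecidableEq ι] (H₀ H₁ : Matrix ι ι ℂ) : Prop :=
  ∀ W ∈ Matrix.specialUnitaryGroup ι ℂ, Reachable H₀ H₁ W

end DegenerateSystem

end

open DegenerateSystem

/-! Lie algebra: write `o` for the ground state. Brackets of operators coupling `o` to two states
yield the coupling between these states, so all of su follows once `o` is coupled to every state
(`mem_of_supported`). This is proved level by level in `ground_couplings_mem`. Bracketing an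
`o`–level `n` coupling with `i H_I` produces, up to terms on levels at most `n` that are already
available, a combination of the two couplings from `o` to level `n + 1`. The two states of level `n`
give two combinations, and the determinant condition separates them. Bracketing with `i H₀`
exchanges `x` and `y`, because the energies differ.

Controllability: let `S` be the semigroup of evolutions under piecewise constant controls. The
conjugates of the generators by `S` span a space containing the generated Lie algebra
(`lieSpan_le_conjugateSpan`). Hence a smooth family in `S` of maximal tangent dimension covers all
directions of that algebra (`exists_hasTangent_lieSpan`), and by the open mapping property `S` has
an interior point in the group (`eventually_mem_image`). Powers of a unitary matrix return near 1 by
compactness, so `S` is a neighbourhood of 1 (`eventually_one_mem`). Every group element is `exp X =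
exp (X / n) ^ n`, hence lies in `S`. -/

noncomputable section

namespace DegenerateSystem

open Matrix

section LieAlgebra

/-! ### Matrix units and the Lie algebra generated by the couplings to one state -/

section Generic

variable {ι : Type} [DecidableEq ι]

/-- `i (|a⟩⟨b| + |b⟩⟨a|)`. -/
def symUnit (a b : ι) : Matrix ι ι ℂ := Complex.I • (single a b 1 + single b a 1)

/-- `|a⟩⟨b| - |b⟩⟨a|`. -/
def skewUnit (a b : ι) : Matrix ι ι ℂ := single a b 1 - single b a 1

lemma skewUnit_swap (a b : ι) : skewUnit b a = -skewUnit a b := by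
  simp [skewUnit]

lemma symUnit_swap (a b : ι) : symUnit b a = symUnit a b := by
  simp [symUnit, add_comm]

variable [Fintype ι]

lemma lie_skewUnit_skewUnit {o a b : ι} (ha : a ≠ o) (hb : b ≠ o) (hab : a ≠ b) :
    ⁅skewUnit o a, skewUnit o b⁆ = skewUnit b a := by
  simp [skewUnit, Ring.lie_def, mul_sub, sub_mul, single_mul_single_of_ne, ha, hb, hab, ha.symm,
    hb.symm, hab.symm]
  abel

lemma lie_symUnit_skewUnit {o a b : ι} (ha : a ≠ o) (hb : b ≠ o) (hab : a ≠ b) :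
    ⁅symUnit o a, skewUnit o b⁆ = symUnit a b := by
  simp [skewUnit, symUnit, Ring.lie_def, mul_sub, sub_mul, mul_add, add_mul,
    single_mul_single_of_ne, ha, hb, hab, ha.symm, hb.symm, hab.symm]

lemma lie_symUnit_skewUnit_self {o a : ι} (ha : a ≠ o) :
    ⁅symUnit o a, skewUnit o a⁆ = symUnit a a - symUnit o o := by
  simp [skewUnit, symUnit, Ring.lie_def, mul_sub, sub_mul, mul_add, add_mul,
    single_mul_single_of_ne, ha, ha.symm]
  abel

/-- Real parts are antisymmetric and imaginary parts symmetric, so each pair is counted twice; hence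
the factor 1/2. The corrections by `symUnit o o` add up to a multiple of the trace, which vanishes.
They turn each diagonal term into a difference that is itself a bracket. -/
lemma eq_sum_of_skewHermitian {A : Matrix ι ι ℂ} (hA : Aᴴ = -A) (htr : A.trace = 0) (o : ι) :
    A = (2⁻¹ : ℝ) • ∑ a, ∑ b, ((A a b).re • skewUnit a b +
      (A a b).im • (symUnit a b - if a = b then symUnit o o else 0)) := by
  have hent (i j) : A j i = -starRingEnd ℂ (A i j) := by
    have := congrFun (congrFun hA j) i
    rw [conjTranspose_apply, Matrix.neg_apply] at this
    rw [← neg_eq_iff_eq_neg, ← this]; rfl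
  have hre (i j) : (A j i).re = -(A i j).re := by rw [hent i j]; simp
  have him (i j) : (A j i).im = (A i j).im := by rw [hent i j]; simp
  have htr' : ∑ a, (A a a).im = 0 := by
    have := congrArg Complex.im htr
    simpa [trace] using this
  have h1 : ∑ a, ∑ b, (A a b).im • (if a = b then symUnit o o else 0 : Matrix ι ι ℂ) = 0 := by
    simp only [smul_ite, smul_zero, Finset.sum_ite_eq, Finset.mem_univ, if_true]
    rw [← Finset.sum_smul, htr', zero_smul]
  simp only [smul_sub, Finset.sum_add_distrib, Finset.sum_sub_distrib, h1, sub_zero]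
  ext i j
  have key (B : ι → ι → ℝ) (i j : ι) :
      (∑ a, ∑ b, B a b • (single a b (1 : ℂ) : Matrix ι ι ℂ)) i j = B i j := by
    simp [Matrix.sum_apply, single_apply, ite_and]
  have key' (B : ι → ι → ℝ) (i j : ι) :
      (∑ a, ∑ b, B a b • (single b a (1 : ℂ) : Matrix ι ι ℂ)) i j = B j i := by
    simp [Matrix.sum_apply, single_apply, ite_and]
  have h2 : (∑ a, ∑ b, (A a b).re • skewUnit a b : Matrix ι ι ℂ) i j = 2 * (A i j).re := by
    simp only [skewUnit, smul_sub, Finset.sum_sub_distrib, Matrix.sub_apply,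
      key (fun a b => (A a b).re), key' (fun a b => (A a b).re)]
    rw [hre i j]; push_cast; ring
  have h3 : (∑ a, ∑ b, (A a b).im • symUnit a b : Matrix ι ι ℂ) i j
      = 2 * (A i j).im * Complex.I := by
    simp only [symUnit, smul_comm _ Complex.I, smul_add, ← Finset.smul_sum,
      Finset.sum_add_distrib, Matrix.add_apply, Matrix.smul_apply, key (fun a b => (A a b).im),
      key' (fun a b => (A a b).im)]
    rw [him i j]; simp; ring
  rw [Matrix.smul_apply, Matrix.add_apply, h2, h3, Complex.real_smul]
  nth_rewrite 1 [← Complex.re_add_im (A i j)]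
  push_cast; ring

/-- A Lie algebra that contains the operators coupling `o` to the states in `T` contains all
traceless skew-Hermitian matrices supported on `T ∪ {o}`. -/
lemma mem_of_supported (L : LieSubalgebra ℝ (Matrix ι ι ℂ)) (o : ι) (T : Set ι)
    (hX : ∀ s ∈ T, s ≠ o → symUnit o s ∈ L) (hY : ∀ s ∈ T, s ≠ o → skewUnit o s ∈ L)
    {A : Matrix ι ι ℂ} (hA : Aᴴ = -A) (htr : A.trace = 0)
    (hsupp : ∀ a b, A a b ≠ 0 → (a ∈ T ∨ a = o) ∧ (b ∈ T ∨ b = o)) : A ∈ L := by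
  rw [eq_sum_of_skewHermitian hA htr o]
  refine L.smul_mem _ (sum_mem fun a _ => sum_mem fun b _ => ?_)
  by_cases h0 : A a b = 0
  · simp [h0]
  obtain ⟨ha, hb⟩ := hsupp a b h0
  have hY' (s : ι) (hs : s ∈ T ∨ s = o) : skewUnit o s ∈ L := by
    by_cases h : s = o
    · subst h; simp [skewUnit]
    · exact hY s (hs.resolve_right h) h
  have hX' (s : ι) (hs : s ∈ T ∨ s = o) (hne : s ≠ o) : symUnit o s ∈ L :=
    hX s (hs.resolve_right hne) hne
  refine L.add_mem (L.smul_mem _ ?_) (L.smul_mem _ ?_)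
  -- Couplings between two states other than `o` are brackets of their couplings to `o`.
  · by_cases hao : a = o
    · subst hao; exact hY' b hb
    by_cases hbo : b = o
    · subst hbo; rw [skewUnit_swap]; exact L.neg_mem (hY' a ha)
    by_cases hab : a = b
    · subst hab; simp [skewUnit]
    rw [← lie_skewUnit_skewUnit hbo hao (Ne.symm hab)]
    exact L.lie_mem (hY' b hb) (hY' a ha)
  · by_cases hab : a = b
    · subst hab
      rw [if_pos rfl]
      by_cases hao : a = o
      · subst hao; simp
      rw [← lie_symUnit_skewUnit_self hao]
      exact L.lie_mem (hX' a ha hao) (hY' a ha)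
    rw [if_neg hab, sub_zero]
    by_cases hao : a = o
    · subst hao; exact hX' b hb (Ne.symm hab)
    by_cases hbo : b = o
    · subst hbo; rw [symUnit_swap]; exact hX' a ha hab
    rw [← lie_symUnit_skewUnit hao hbo hab]
    exact L.lie_mem (hX' a ha hao) (hY' b hb)

lemma lie_diagonal_symUnit (e : ι → ℝ) (a b : ι) :
    ⁅Complex.I • diagonal (fun s => (e s : ℂ)), symUnit a b⁆ = (e b - e a) • skewUnit a b := by
  ext i j
  simp only [symUnit, skewUnit, Ring.lie_def, Matrix.sub_apply, smul_mul_assoc, mul_smul_comm,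
    Matrix.smul_apply, diagonal_mul, mul_diagonal, Matrix.add_apply, single_apply, smul_eq_mul,
    Complex.real_smul]
  linear_combination (norm := skip) ((e i : ℂ) - e j) *
    ((if a = i ∧ b = j then 1 else 0) + if b = i ∧ a = j then 1 else 0) * Complex.I_mul_I
  push_cast
  split_ifs with h1 h2 h2
  · obtain ⟨rfl, rfl⟩ := h1; obtain ⟨rfl, -⟩ := h2; ring
  · obtain ⟨rfl, rfl⟩ := h1; ring
  · obtain ⟨rfl, rfl⟩ := h2; ring
  · ring

lemma lie_diagonal_skewUnit (e : ι → ℝ) (a b : ι) :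
    ⁅Complex.I • diagonal (fun s => (e s : ℂ)), skewUnit a b⁆ = (e a - e b) • symUnit a b := by
  ext i j
  simp only [symUnit, skewUnit, Ring.lie_def, Matrix.sub_apply, smul_mul_assoc, mul_smul_comm,
    Matrix.smul_apply, diagonal_mul, mul_diagonal, Matrix.add_apply, single_apply, smul_eq_mul,
    Complex.real_smul]
  push_cast
  split_ifs with h1 h2 h2
  · obtain ⟨rfl, rfl⟩ := h1; obtain ⟨rfl, -⟩ := h2; ring
  · obtain ⟨rfl, rfl⟩ := h1; ring
  · obtain ⟨rfl, rfl⟩ := h2; ring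
  · ring

end Generic

/-! ### The Hamiltonians in the basis of states, and the induction on levels -/

variable {N : ℕ}

lemma mem_labels {n k : ℕ} : (n, k) ∈ labels N ↔ (1 ≤ n ∧ n ≤ N) ∧ 1 ≤ k ∧ k ≤ deg n := by
  have : deg n ≤ 2 := by unfold deg; split_ifs <;> omega
  simp only [labels, Finset.mem_filter, Finset.mem_product, Finset.mem_Icc]
  omega

lemma ketbra_eq_single {n k m l : ℕ} (h : (n, k) ∈ labels N) (h' : (m, l) ∈ labels N) :
    ketbra N n k m l = single (⟨(n, k), h⟩ : State N) ⟨(m, l), h'⟩ 1 := by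
  ext a b
  simp only [ketbra, of_apply, single_apply, Subtype.ext_iff, eq_comm]

lemma xOp_eq_symUnit {n k m l : ℕ} (h : (n, k) ∈ labels N) (h' : (m, l) ∈ labels N) :
    xOp N n k m l = symUnit (⟨(n, k), h⟩ : State N) ⟨(m, l), h'⟩ := by
  rw [xOp, symUnit, ketbra_eq_single h h', ketbra_eq_single h' h]

lemma yOp_eq_skewUnit {n k m l : ℕ} (h : (n, k) ∈ labels N) (h' : (m, l) ∈ labels N) :
    yOp N n k m l = skewUnit (⟨(n, k), h⟩ : State N) ⟨(m, l), h'⟩ := by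
  rw [yOp, skewUnit, ketbra_eq_single h h', ketbra_eq_single h' h]

lemma freeHamiltonian_eq_diagonal (E : ℕ → ℝ) :
    freeHamiltonian N E = diagonal (fun s : State N => (E s.1.1 : ℂ)) := by
  ext ⟨⟨n, k⟩, h⟩ b
  have hl := mem_labels.1 h
  simp only [freeHamiltonian, Matrix.sum_apply, Matrix.smul_apply, ketbra, of_apply, smul_eq_mul,
    diagonal_apply]
  rw [Finset.sum_eq_single n, Finset.sum_eq_single k]
  · simp [Subtype.ext_iff, eq_comm]
  · intro k' _ hk; simp [hk.symm]
  · intro hk; exact absurd (Finset.mem_Icc.2 hl.2) hk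
  · intro n' _ hn; exact Finset.sum_eq_zero fun k' _ => by simp [hn.symm]
  · intro hn; exact absurd (Finset.mem_Icc.2 hl.1) hn

/-- The amplitude of the transition `a → b` when `b` lies one level above `a`, and `0` otherwise. -/
def coupling (d : ℕ → ℕ → ℕ → ℝ) (a b : State N) : ℝ :=
  if b.1.1 = a.1.1 + 1 then d a.1.1 a.1.2 b.1.2 else 0

lemma sum_eq_coupling (d : ℕ → ℕ → ℕ → ℝ) (a b : State N) :
    (∑ n ∈ Finset.Icc 1 (N - 1), ∑ k ∈ Finset.Icc 1 (deg n), ∑ p ∈ Finset.Icc 1 2,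
      (d n k p : ℂ) * (if a.1 = (n, k) ∧ b.1 = (n + 1, p) then 1 else 0)) = coupling d a b := by
  obtain ⟨⟨n, k⟩, h⟩ := a
  obtain ⟨⟨m, p⟩, h'⟩ := b
  have hl := mem_labels.1 h
  have hl' := mem_labels.1 h'
  have hdeg : deg m ≤ 2 := by unfold deg; split_ifs <;> omega
  by_cases hm : m = n + 1
  · subst hm
    rw [Finset.sum_eq_single n, Finset.sum_eq_single k, Finset.sum_eq_single p]
    · simp [coupling]
    · intro p' _ hp; simp [hp.symm]
    · intro hp; exact absurd (Finset.mem_Icc.2 ⟨hl'.2.1, hl'.2.2.trans hdeg⟩) hp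
    · intro k' _ hk; exact Finset.sum_eq_zero fun p' _ => by simp [hk.symm]
    · intro hk; exact absurd (Finset.mem_Icc.2 hl.2) hk
    · intro n' _ hn
      exact Finset.sum_eq_zero fun k' _ => Finset.sum_eq_zero fun p' _ => by simp [hn.symm]
    · intro hn; exact absurd (Finset.mem_Icc.2 ⟨hl.1.1, by omega⟩) hn
  · rw [coupling, if_neg hm, Complex.ofReal_zero]
    refine Finset.sum_eq_zero fun n' _ => Finset.sum_eq_zero fun k' _ =>
      Finset.sum_eq_zero fun p' _ => ?_
    rw [if_neg, mul_zero]
    simp only [Prod.mk.injEq]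
    rintro ⟨⟨rfl, -⟩, hm', -⟩
    exact hm hm'

lemma dipoleHamiltonian_apply (d : ℕ → ℕ → ℕ → ℝ) (a b : State N) :
    dipoleHamiltonian N d a b = coupling d a b + coupling d b a := by
  rw [← sum_eq_coupling d a b, ← sum_eq_coupling d b a]
  simp only [dipoleHamiltonian, Matrix.sum_apply, Matrix.smul_apply, Matrix.add_apply, ketbra,
    of_apply, smul_eq_mul, mul_add, Finset.sum_add_distrib]
  simp only [and_comm]

lemma freeHamiltonian_conjTranspose (E : ℕ → ℝ) :
    (freeHamiltonian N E)ᴴ = freeHamiltonian N E := by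
  rw [freeHamiltonian_eq_diagonal, diagonal_conjTranspose]
  congr 1; ext s; simp

lemma dipoleHamiltonian_conjTranspose (d : ℕ → ℕ → ℕ → ℝ) :
    (dipoleHamiltonian N d)ᴴ = dipoleHamiltonian N d := by
  ext a b
  rw [conjTranspose_apply, dipoleHamiltonian_apply, dipoleHamiltonian_apply]
  simp [add_comm]

lemma dipoleHamiltonian_trace (d : ℕ → ℕ → ℕ → ℝ) : (dipoleHamiltonian N d).trace = 0 := by
  simp [trace, dipoleHamiltonian_apply, coupling]

lemma lie_dipole_skewUnit_apply (d : ℕ → ℕ → ℕ → ℝ) (o q a b : State N) :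
    (⁅Complex.I • dipoleHamiltonian N d, skewUnit o q⁆ : Op N) a b =
      Complex.I * (dipoleHamiltonian N d a o * (if q = b then 1 else 0)
        - dipoleHamiltonian N d a q * (if o = b then 1 else 0)
        - (if o = a then 1 else 0) * dipoleHamiltonian N d q b
        + (if q = a then 1 else 0) * dipoleHamiltonian N d o b) := by
  simp [skewUnit, Ring.lie_def, mul_apply, single_apply, mul_sub, sub_mul, ite_and]
  split_ifs <;> ring

lemma symUnit_apply (o q a b : State N) : symUnit o q a b =
    Complex.I * ((if o = a ∧ q = b then 1 else 0) + (if q = a ∧ o = b then 1 else 0)) := by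
  simp [symUnit, single_apply]

lemma state_bounds (s : State N) :
    (1 ≤ s.1.1 ∧ s.1.1 ≤ N) ∧ 1 ≤ s.1.2 ∧ s.1.2 ≤ deg s.1.1 :=
  mem_labels.1 s.2

lemma conjTranspose_I_smul {ι : Type} {H : Matrix ι ι ℂ} (hH : Hᴴ = H) :
    (Complex.I • H)ᴴ = -(Complex.I • H) := by
  rw [conjTranspose_smul, hH]; simp

lemma symUnit_conjTranspose {ι : Type} [DecidableEq ι] (a b : ι) :
    (symUnit a b)ᴴ = -symUnit a b := by
  refine conjTranspose_I_smul ?_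
  rw [conjTranspose_add, conjTranspose_single, conjTranspose_single, add_comm]; simp

lemma skewUnit_conjTranspose {ι : Type} [DecidableEq ι] (a b : ι) :
    (skewUnit a b)ᴴ = -skewUnit a b := by
  simp [skewUnit, conjTranspose_single]

lemma I_smul_free_mem (E : ℕ → ℝ) (d : ℕ → ℕ → ℕ → ℝ) :
    Complex.I • freeHamiltonian N E ∈ dynamicalLieAlgebra N E d :=
  LieSubalgebra.subset_lieSpan (Set.mem_insert _ _)

lemma I_smul_dipole_mem (E : ℕ → ℝ) (d : ℕ → ℕ → ℕ → ℝ) :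
    Complex.I • dipoleHamiltonian N d ∈ dynamicalLieAlgebra N E d :=
  LieSubalgebra.subset_lieSpan (Set.mem_insert_of_mem _ rfl)

lemma smul_mem_cancel {V : Type*} [AddCommGroup V] [Module ℝ V] {p : Submodule ℝ V} {c : ℝ}
    (hc : c ≠ 0) {x : V} (h : c • x ∈ p) : x ∈ p :=
  (Submodule.smul_mem_iff p hc).1 h

lemma skewUnit_mem_of_symUnit_mem {E : ℕ → ℝ} {d : ℕ → ℕ → ℕ → ℝ} {a b : State N}
    (hE : E a.1.1 ≠ E b.1.1) (h : symUnit a b ∈ dynamicalLieAlgebra N E d) :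
    skewUnit a b ∈ dynamicalLieAlgebra N E d := by
  have := (dynamicalLieAlgebra N E d).lie_mem (I_smul_free_mem E d) h
  rw [freeHamiltonian_eq_diagonal, lie_diagonal_symUnit (fun s : State N => E s.1.1)] at this
  exact smul_mem_cancel (p := (dynamicalLieAlgebra N E d).toSubmodule) (sub_ne_zero.2 hE.symm) this

lemma symUnit_mem_of_skewUnit_mem {E : ℕ → ℝ} {d : ℕ → ℕ → ℕ → ℝ} {a b : State N}
    (hE : E a.1.1 ≠ E b.1.1) (h : skewUnit a b ∈ dynamicalLieAlgebra N E d) :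
    symUnit a b ∈ dynamicalLieAlgebra N E d := by
  have := (dynamicalLieAlgebra N E d).lie_mem (I_smul_free_mem E d) h
  rw [freeHamiltonian_eq_diagonal, lie_diagonal_skewUnit (fun s : State N => E s.1.1)] at this
  exact smul_mem_cancel (p := (dynamicalLieAlgebra N E d).toSubmodule) (sub_ne_zero.2 hE) this

/-- `H_I` sends `o` only to level 2, hence not above level `n`. In the columns above `n` the bracket
therefore retains only the transitions from `q` up to level `n + 1`, in row `o`, and the added
couplings cancel these. -/
lemma lie_dipole_add_supported (d : ℕ → ℕ → ℕ → ℝ) {n k : ℕ} (hn : 2 ≤ n) {o q u₁ u₂ : State N}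
    (ho : o.1 = (1, 1)) (hq : q.1 = (n, k)) (hu₁ : u₁.1 = (n + 1, 1)) (hu₂ : u₂.1 = (n + 1, 2))
    (a b : State N) (hb : n < b.1.1) :
    (⁅Complex.I • dipoleHamiltonian N d, skewUnit o q⁆ +
      (d n k 1 • symUnit o u₁ + d n k 2 • symUnit o u₂) : Op N) a b = 0 := by
  have hqb : q ≠ b := by rintro rfl; rw [hq] at hb; exact lt_irrefl _ hb
  have hob : o ≠ b := by rintro rfl; rw [ho] at hb; simp at hb; omega
  have hHo : dipoleHamiltonian N d o b = 0 := by
    rw [dipoleHamiltonian_apply, coupling, coupling, if_neg, if_neg] <;> simp [ho] <;> omega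
  rw [Matrix.add_apply, lie_dipole_skewUnit_apply, Matrix.add_apply, Matrix.smul_apply,
    Matrix.smul_apply, symUnit_apply, symUnit_apply, if_neg hqb, if_neg hob, hHo,
    Complex.real_smul, Complex.real_smul]
  by_cases hoa : o = a
  swap
  · simp [hoa, hob]
  have hHq : dipoleHamiltonian N d q b = if b.1.1 = n + 1 then (d n k b.1.2 : ℂ) else 0 := by
    have h : ¬ n = b.1.1 + 1 := by omega
    rw [dipoleHamiltonian_apply, coupling, coupling, hq]
    split_ifs <;> simp
  simp only [hoa, true_and, if_true, hHq]
  by_cases hb1 : b.1.1 = n + 1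
  · have hb2 := state_bounds b
    have hdeg : deg b.1.1 = 2 := if_neg (by omega)
    rw [hdeg] at hb2
    have h12 : b.1.2 = 1 ∨ b.1.2 = 2 := by omega
    rcases h12 with h | h
    · have e1 : u₁ = b := Subtype.ext (by rw [hu₁, ← hb1, ← h])
      have e2 : u₂ ≠ b := by
        rintro rfl; rw [hu₂] at h; simp at h
      subst e1
      simp [← hoa, hob, e2, hu₁, mul_comm]
    · have e2 : u₂ = b := Subtype.ext (by rw [hu₂, ← hb1, ← h])
      have e1 : u₁ ≠ b := by
        rintro rfl; rw [hu₁] at h; simp at h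
      subst e2
      simp [← hoa, hob, e1, hu₂, mul_comm]
  · have e1 : u₁ ≠ b := by rintro rfl; exact hb1 (by rw [hu₁])
    have e2 : u₂ ≠ b := by rintro rfl; exact hb1 (by rw [hu₂])
    simp [← hoa, hob, e1, e2, hb1]

/-- The bracket `B` lies in the algebra. `B + C` is traceless, skew-Hermitian and supported on
levels at most `n`, so the couplings known up to level `n` generate it; subtracting leaves `C`. -/
lemma combination_mem {E : ℕ → ℝ} {d : ℕ → ℕ → ℕ → ℝ} {n k : ℕ} (hn : 2 ≤ n)
    {o q u₁ u₂ : State N}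
    (ho : o.1 = (1, 1)) (hq : q.1 = (n, k)) (hu₁ : u₁.1 = (n + 1, 1)) (hu₂ : u₂.1 = (n + 1, 2))
    (hX : ∀ s : State N, s.1.1 ≤ n → s ≠ o → symUnit o s ∈ dynamicalLieAlgebra N E d)
    (hY : ∀ s : State N, s.1.1 ≤ n → s ≠ o → skewUnit o s ∈ dynamicalLieAlgebra N E d) :
    d n k 1 • symUnit o u₁ + d n k 2 • symUnit o u₂ ∈ dynamicalLieAlgebra N E d := by
  have hqo : q ≠ o := by rintro rfl; rw [ho] at hq; simp at hq; omega
  have hu₁o : u₁ ≠ o := by rintro rfl; rw [ho] at hu₁; simp at hu₁; omega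
  have hu₂o : u₂ ≠ o := by rintro rfl; rw [ho] at hu₂; simp at hu₂
  have hlie := (dynamicalLieAlgebra N E d).lie_mem (I_smul_dipole_mem E d)
    (hY q (by rw [hq]) hqo)
  set B := ⁅Complex.I • dipoleHamiltonian N d, skewUnit o q⁆ with hB
  set C := d n k 1 • symUnit o u₁ + d n k 2 • symUnit o u₂ with hC
  have hskew : (B + C)ᴴ = -(B + C) := by
    refine (unitaryLieAlgebra (State N)).add_mem ((unitaryLieAlgebra (State N)).lie_mem
      (conjTranspose_I_smul (dipoleHamiltonian_conjTranspose d)) (skewUnit_conjTranspose o q)) ?_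
    exact (unitaryLieAlgebra (State N)).add_mem
      ((unitaryLieAlgebra (State N)).smul_mem _ (symUnit_conjTranspose _ _))
      ((unitaryLieAlgebra (State N)).smul_mem _ (symUnit_conjTranspose _ _))
  have htr : (B + C).trace = 0 := by
    rw [trace_add, hB, Ring.lie_def, trace_sub, trace_mul_comm, sub_self, zero_add, hC]
    simp [symUnit, hu₁o, hu₂o, hu₁o.symm, hu₂o.symm]
  have hcol (a b : State N) (hb : n < b.1.1) : (B + C) a b = 0 :=
    lie_dipole_add_supported d hn ho hq hu₁ hu₂ a b hb
  have hrow (a b : State N) (ha : n < a.1.1) : (B + C) a b = 0 := by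
    have := congrFun (congrFun hskew b) a
    rw [conjTranspose_apply, Matrix.neg_apply, hcol b a ha, neg_zero] at this
    exact star_eq_zero.1 this
  have hmem : B + C ∈ dynamicalLieAlgebra N E d := by
    refine mem_of_supported _ o {s | s.1.1 ≤ n} hX hY hskew htr fun a b hab => ?_
    constructor
    · left; by_contra h; exact hab (hrow a b (not_le.1 h))
    · left; by_contra h; exact hab (hcol a b (not_le.1 h))
  simpa using (dynamicalLieAlgebra N E d).sub_mem hmem hlie

lemma mem_of_combinations_mem {V : Type*} [AddCommGroup V] [Module ℝ V] {p : Submodule ℝ V}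
    {x y : V} {a b c e : ℝ} (hdet : a * e ≠ b * c) (h₁ : a • x + b • y ∈ p)
    (h₂ : c • x + e • y ∈ p) : x ∈ p ∧ y ∈ p := by
  have h : a * e - b * c ≠ 0 := sub_ne_zero.2 hdet
  constructor
  · refine smul_mem_cancel h ?_
    convert! p.sub_mem (p.smul_mem e h₁) (p.smul_mem b h₂) using 1
    module
  · refine smul_mem_cancel h ?_
    convert! p.sub_mem (p.smul_mem a h₂) (p.smul_mem c h₁) using 1
    module

lemma ground_couplings_mem {E : ℕ → ℝ} {d : ℕ → ℕ → ℕ → ℝ}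
    (hE : ∀ n, 1 ≤ n → n ≤ N - 1 → E n < E (n + 1))
    (hd : ∀ n, 2 ≤ n → n ≤ N - 1 → d n 1 1 * d n 2 2 ≠ d n 1 2 * d n 2 1)
    (hxy :
      (xOp N 1 1 2 1 ∈ dynamicalLieAlgebra N E d ∧ xOp N 1 1 2 2 ∈ dynamicalLieAlgebra N E d) ∨
      (yOp N 1 1 2 1 ∈ dynamicalLieAlgebra N E d ∧ yOp N 1 1 2 2 ∈ dynamicalLieAlgebra N E d))
    {o : State N} (ho : o.1 = (1, 1)) (s : State N) (hs : s ≠ o) :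
    symUnit o s ∈ dynamicalLieAlgebra N E d ∧ skewUnit o s ∈ dynamicalLieAlgebra N E d := by
  have hE1 (n : ℕ) (hn : 2 ≤ n) (hnN : n ≤ N) : E 1 < E n := by
    induction n, hn using Nat.le_induction with
    | base => exact hE 1 le_rfl (by omega)
    | succ n hn ih => exact (ih (by omega)).trans (hE n (by omega) (by omega))
  suffices H : ∀ n, 2 ≤ n → ∀ s : State N, s.1.1 ≤ n → s ≠ o →
      symUnit o s ∈ dynamicalLieAlgebra N E d ∧ skewUnit o s ∈ dynamicalLieAlgebra N E d from
    -- The induction starts at level 2; adding 2 meets this bound for every state.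
    H (s.1.1 + 2) (by omega) s (by omega) hs
  have hE' (s : State N) (hs : 2 ≤ s.1.1) : E o.1.1 ≠ E s.1.1 := by
    rw [ho]; exact (hE1 _ hs (state_bounds s).1.2).ne
  have hlvl (s : State N) (hs : s ≠ o) : 2 ≤ s.1.1 := by
    have h := state_bounds s
    by_contra hlt
    have h1 : s.1.1 = 1 := by omega
    rw [h1, deg, if_pos rfl] at h
    exact hs (Subtype.ext (by rw [ho]; exact Prod.ext h1 (by change s.1.2 = 1; omega)))
  intro n hn
  induction n, hn using Nat.le_induction with
  | base =>
    intro s hs hso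
    have h2 : s.1.1 = 2 := le_antisymm hs (hlvl s hso)
    have hE2 := hE' s h2.ge
    have h := state_bounds s
    have hdeg : deg s.1.1 = 2 := if_neg (by omega)
    rw [hdeg] at h
    have h12 : s.1.2 = 1 ∨ s.1.2 = 2 := by omega
    have hor : symUnit o s ∈ dynamicalLieAlgebra N E d ∨
        skewUnit o s ∈ dynamicalLieAlgebra N E d := by
      obtain ⟨⟨m, l⟩, hml⟩ := s
      obtain ⟨⟨m', l'⟩, hml'⟩ := o
      simp only [Prod.mk.injEq] at h2 h12 ho
      obtain ⟨rfl, rfl⟩ := ho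
      subst h2
      rw [← xOp_eq_symUnit, ← yOp_eq_skewUnit]
      rcases h12 with rfl | rfl
      · exact hxy.imp (·.1) (·.1)
      · exact hxy.imp (·.2) (·.2)
    rcases hor with h | h
    · exact ⟨h, skewUnit_mem_of_symUnit_mem hE2 h⟩
    · exact ⟨symUnit_mem_of_skewUnit_mem hE2 h, h⟩
  | succ n hn ih =>
    intro s hs hso
    by_cases hsn : s.1.1 ≤ n
    · exact ih s hsn hso
    have hs1 : s.1.1 = n + 1 := by omega
    have h := state_bounds s
    have hdeg : ∀ m, 2 ≤ m → deg m = 2 := fun m hm => if_neg (by omega)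
    rw [hdeg _ (hlvl s hso), hs1] at h
    let st (m k : ℕ) (hm : 2 ≤ m ∧ m ≤ N) (hk : 1 ≤ k ∧ k ≤ 2) : State N :=
      ⟨(m, k), mem_labels.2 ⟨⟨by omega, hm.2⟩, hk.1, by rw [hdeg m hm.1]; exact hk.2⟩⟩
    have comb (k : ℕ) (hk : 1 ≤ k ∧ k ≤ 2) := combination_mem (E := E) (d := d) hn (k := k)
      (o := o) (q := st n k ⟨hn, by omega⟩ hk) (u₁ := st (n + 1) 1 (by omega) (by omega))
      (u₂ := st (n + 1) 2 (by omega) (by omega)) ho rfl rfl rfl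
      (fun s h h' => (ih s h h').1) (fun s h h' => (ih s h h').2)
    -- The two states of level `n` give a 2×2 system with nonzero determinant.
    have hmem := mem_of_combinations_mem (p := (dynamicalLieAlgebra N E d).toSubmodule)
      (hd n hn (by omega)) (comb 1 (by omega)) (comb 2 (by omega))
    have hsym : symUnit o s ∈ dynamicalLieAlgebra N E d := by
      have h12 : s.1.2 = 1 ∨ s.1.2 = 2 := by omega
      rcases h12 with h' | h'
      · convert! hmem.1 using 2
        exact Subtype.ext (Prod.ext hs1 h')
      · convert! hmem.2 using 2
        exact Subtype.ext (Prod.ext hs1 h')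
    exact ⟨hsym, skewUnit_mem_of_symUnit_mem (hE' s (hlvl s hso)) hsym⟩

lemma specialUnitary_le_dynamical {E : ℕ → ℝ} {d : ℕ → ℕ → ℕ → ℝ} (hN : 3 ≤ N)
    (hE : ∀ n, 1 ≤ n → n ≤ N - 1 → E n < E (n + 1))
    (hd : ∀ n, 2 ≤ n → n ≤ N - 1 → d n 1 1 * d n 2 2 ≠ d n 1 2 * d n 2 1)
    (hxy :
      (xOp N 1 1 2 1 ∈ dynamicalLieAlgebra N E d ∧ xOp N 1 1 2 2 ∈ dynamicalLieAlgebra N E d) ∨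
      (yOp N 1 1 2 1 ∈ dynamicalLieAlgebra N E d ∧ yOp N 1 1 2 2 ∈ dynamicalLieAlgebra N E d)) :
    specialUnitaryLieAlgebra (State N) ≤ dynamicalLieAlgebra N E d := by
  rintro A ⟨hA, htr⟩
  let o : State N := ⟨(1, 1), mem_labels.2 ⟨⟨le_rfl, by omega⟩, le_rfl, by simp [deg]⟩⟩
  have key := ground_couplings_mem hE hd hxy (o := o) rfl
  exact mem_of_supported _ o Set.univ (fun s _ h => (key s h).1) (fun s _ h => (key s h).2) hA htr
    fun a b _ => ⟨Or.inl trivial, Or.inl trivial⟩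

lemma trace_eq_im_mul_I {ι : Type} [Fintype ι] {B : Matrix ι ι ℂ} (hB : Bᴴ = -B) :
    B.trace = B.trace.im * Complex.I := by
  have h := congrArg trace hB
  rw [trace_conjTranspose, trace_neg] at h
  have hre := congrArg Complex.re h
  simp at hre
  apply Complex.ext <;> simp
  linarith

/-! ### From the inclusion of su to equality with su or u -/

section Span

variable {ι : Type} [Fintype ι] [DecidableEq ι]

lemma lieSpan_eq_specialUnitary {H₀ H₁ : Matrix ι ι ℂ} (h₀ : H₀ᴴ = H₀) (h₁ : H₁ᴴ = H₁)
    (htr₀ : H₀.trace = 0) (htr₁ : H₁.trace = 0)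
    (hle : specialUnitaryLieAlgebra ι ≤
      LieSubalgebra.lieSpan ℝ (Matrix ι ι ℂ) {Complex.I • H₀, Complex.I • H₁}) :
    LieSubalgebra.lieSpan ℝ (Matrix ι ι ℂ) {Complex.I • H₀, Complex.I • H₁} =
      specialUnitaryLieAlgebra ι := by
  refine le_antisymm (LieSubalgebra.lieSpan_le.2 ?_) hle
  rintro _ (rfl | rfl)
  · exact ⟨conjTranspose_I_smul h₀, by rw [trace_smul, htr₀, smul_zero]⟩
  · exact ⟨conjTranspose_I_smul h₁, by rw [trace_smul, htr₁, smul_zero]⟩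

lemma lieSpan_eq_unitary {H₀ H₁ : Matrix ι ι ℂ} (h₀ : H₀ᴴ = H₀) (h₁ : H₁ᴴ = H₁)
    (htr₀ : H₀.trace ≠ 0)
    (hle : specialUnitaryLieAlgebra ι ≤
      LieSubalgebra.lieSpan ℝ (Matrix ι ι ℂ) {Complex.I • H₀, Complex.I • H₁}) :
    LieSubalgebra.lieSpan ℝ (Matrix ι ι ℂ) {Complex.I • H₀, Complex.I • H₁} =
      unitaryLieAlgebra ι := by
  have hH₀ : Complex.I • H₀ ∈ unitaryLieAlgebra ι := conjTranspose_I_smul h₀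
  refine le_antisymm (LieSubalgebra.lieSpan_le.2 ?_) fun A hA => ?_
  · rintro _ (rfl | rfl)
    · exact hH₀
    · exact conjTranspose_I_smul h₁
  set t := (Complex.I • H₀).trace with ht
  have ht0 : t ≠ 0 := by simp [ht, htr₀]
  have htim : t.im ≠ 0 := fun h => ht0 (by rw [ht, trace_eq_im_mul_I hH₀, ← ht, h]; simp)
  -- Traces of skew-Hermitian matrices are purely imaginary, so a real multiple of `i H₀` removes
  -- the trace of `A`.
  have hmem : A - (A.trace.im / t.im) • (Complex.I • H₀) ∈ specialUnitaryLieAlgebra ι := by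
    refine ⟨(unitaryLieAlgebra ι).sub_mem hA ((unitaryLieAlgebra ι).smul_mem _ hH₀), ?_⟩
    rw [trace_sub, trace_smul (A.trace.im / t.im), ← ht, trace_eq_im_mul_I hA, Complex.real_smul]
    have htI : t = t.im * Complex.I := trace_eq_im_mul_I hH₀
    have : (t.im : ℂ) ≠ 0 := by exact_mod_cast htim
    nth_rewrite 2 [htI]
    simp; field_simp; simp
  have := LieSubalgebra.add_mem _ (hle hmem) (LieSubalgebra.smul_mem _ (A.trace.im / t.im)
    (LieSubalgebra.subset_lieSpan (R := ℝ) (Set.mem_insert (Complex.I • H₀) {Complex.I • H₁})))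
  simpa using this

end Span

end LieAlgebra

/-! ### Piecewise constant controls and their evolution operators -/

section Controllability

open NormedSpace Set MeasureTheory Filter
open scoped Matrix.Norms.L2Operator Topology

variable {ι : Type} [Fintype ι] [DecidableEq ι]

/-- The generator `-i (H₀ + c H₁)` of the evolution under the constant control `c`. -/
def generator (H₀ H₁ : Matrix ι ι ℂ) (c : ℝ) : Matrix ι ι ℂ :=
  (-Complex.I) • (H₀ + (c : ℂ) • H₁)

/-- The evolution operators of the nonnegative-time constant controls. -/
def evolutions (H₀ H₁ : Matrix ι ι ℂ) : Set (Matrix ι ι ℂ) :=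
  {X | ∃ t : ℝ, 0 ≤ t ∧ ∃ c : ℝ, X = exp (t • generator H₀ H₁ c)}

/-- The evolution operators of the piecewise constant controls. -/
def evolutionSemigroup (H₀ H₁ : Matrix ι ι ℂ) : Submonoid (Matrix ι ι ℂ) :=
  Submonoid.closure (evolutions H₀ H₁)

lemma exp_smul_generator_mem (H₀ H₁ : Matrix ι ι ℂ) {t : ℝ} (ht : 0 ≤ t) (c : ℝ) :
    exp (t • generator H₀ H₁ c) ∈ evolutionSemigroup H₀ H₁ :=
  Submonoid.subset_closure ⟨t, ht, c, rfl⟩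

lemma hasDerivAt_exp_smul (A : Matrix ι ι ℂ) (t : ℝ) :
    HasDerivAt (fun u : ℝ => exp (u • A)) (A * exp (t • A)) t :=
  (hasStrictDerivAt_exp_smul_const' A t).hasDerivAt

lemma continuous_exp_smul (A : Matrix ι ι ℂ) : Continuous fun u : ℝ => exp (u • A) :=
  continuous_iff_continuousAt.2 fun t => (hasDerivAt_exp_smul A t).continuousAt

lemma reachable_one (H₀ H₁ : Matrix ι ι ℂ) : Reachable H₀ H₁ 1 := by
  refine ⟨0, le_rfl, 0, measurable_const, ⟨0, by simp⟩, fun _ => 1, ⟨continuousOn_const, ?_⟩, rfl⟩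
  intro t ht a b
  obtain rfl : t = 0 := le_antisymm ht.2 ht.1
  simp

lemma hasDerivAt_entry {U : ℝ → Matrix ι ι ℂ} {U' : Matrix ι ι ℂ} {t : ℝ} (h : HasDerivAt U U' t)
    (a b : ι) : HasDerivAt (fun s => U s a b) (U' a b) t := by
  let φ : Matrix ι ι ℂ →ₗ[ℝ] ℂ :=
    { toFun := fun M => M a b, map_add' := fun _ _ => rfl, map_smul' := fun _ _ => rfl }
  exact (LinearMap.toContinuousLinearMap φ).hasFDerivAt.comp_hasDerivAt t h

lemma continuousOn_entry {U : ℝ → Matrix ι ι ℂ} {s : Set ℝ} (h : ContinuousOn U s) (a b : ι) :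
    ContinuousOn (fun t => U t a b) s :=
  (Continuous.matrix_elem continuous_id a b).comp_continuousOn h

lemma intervalIntegrable_of_bounded {f : ℝ → ℝ} (hf : Measurable f) {C : ℝ}
    (hC : ∀ t, |f t| ≤ C) (a b : ℝ) :
    IntervalIntegrable (fun t => (f t : ℂ)) volume a b := by
  refine (intervalIntegrable_const (c := C)).mono_fun
    (Complex.measurable_ofReal.comp hf).aestronglyMeasurable ?_
  refine Filter.Eventually.of_forall fun t => ?_
  simpa using (hC t).trans (le_abs_self C)

lemma intervalIntegrable_schrodinger (H₀ H₁ : Matrix ι ι ℂ) {f : ℝ → ℝ} (hf : Measurable f)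
    {C : ℝ} (hC : ∀ t, |f t| ≤ C) {T : ℝ} (hT : 0 ≤ T) {U : ℝ → Matrix ι ι ℂ}
    (hU : ContinuousOn U (Icc 0 T)) (a b : ι) :
    IntervalIntegrable (fun s => (-Complex.I) * (((H₀ + (f s : ℂ) • H₁) * U s) a b))
      volume 0 T := by
  have hcont (H : Matrix ι ι ℂ) : ContinuousOn (fun s => (H * U s) a b) (uIcc 0 T) := by
    rw [uIcc_of_le hT]
    exact continuousOn_entry (continuousOn_const.mul hU) a b
  simp only [add_mul, smul_mul_assoc, Matrix.add_apply, Matrix.smul_apply, smul_eq_mul]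
  exact ((hcont H₀).intervalIntegrable.add
    ((intervalIntegrable_of_bounded hf hC 0 T).mul_continuousOn (hcont H₁))).const_mul _

lemma generator_mul_apply (H₀ H₁ V : Matrix ι ι ℂ) (c : ℝ) (a b : ι) :
    (generator H₀ H₁ c * V) a b = (-Complex.I) * (((H₀ + (c : ℂ) • H₁) * V) a b) := by
  rw [generator, smul_mul_assoc, Matrix.smul_apply, smul_eq_mul]

/-- Controls are concatenated: after time `T` the constant `c` is applied for a duration `τ`. -/
lemma reachable_exp_mul {H₀ H₁ W : Matrix ι ι ℂ} (hW : Reachable H₀ H₁ W) {τ : ℝ} (hτ : 0 ≤ τ)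
    (c : ℝ) : Reachable H₀ H₁ (exp (τ • generator H₀ H₁ c) * W) := by
  obtain ⟨T, hT, f, hf, ⟨C, hC⟩, U, ⟨hUc, hU⟩, rfl⟩ := hW
  set A := generator H₀ H₁ c with hA
  set g : ℝ → ℝ := fun s => if s ≤ T then f s else c with hg
  -- Truncating both times writes the glued evolution as a single product, so its continuity needs
  -- no case split.
  set V : ℝ → Matrix ι ι ℂ := fun s => exp (max (s - T) 0 • A) * U (min s T) with hV
  have hV1 {s : ℝ} (hs : s ≤ T) : V s = U s := by simp [hV, hs]
  have hV2 {s : ℝ} (hs : T ≤ s) : V s = exp ((s - T) • A) * U T := by simp [hV, hs]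
  have hgm : Measurable g := Measurable.ite measurableSet_Iic hf measurable_const
  have hVc : ContinuousOn V (Icc 0 (T + τ)) := by
    refine ContinuousOn.mul ((continuous_exp_smul A).comp (by fun_prop)).continuousOn ?_
    refine hUc.comp (by fun_prop) fun s hs => ?_
    exact ⟨le_min hs.1 hT, min_le_right _ _⟩
  refine ⟨T + τ, add_nonneg hT hτ, g, hgm, ⟨max C |c|, fun t => ?_⟩, V, ⟨hVc, ?_⟩, ?_⟩
  · by_cases ht : t ≤ T
    · simp [hg, ht, hC t]
    · simp [hg, ht]
  · have hfirst {t : ℝ} (ht0 : 0 ≤ t) (ht : t ≤ T) (a b : ι) :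
        U t a b = (1 : Matrix ι ι ℂ) a b +
        ∫ s in (0 : ℝ)..t, (-Complex.I) * (((H₀ + (g s : ℂ) • H₁) * V s) a b) := by
      rw [hU t ⟨ht0, ht⟩ a b]
      congr 1
      refine intervalIntegral.integral_congr fun s hs => ?_
      rw [uIcc_of_le ht0] at hs
      have hsT : s ≤ T := hs.2.trans ht
      simp only [hV1 hsT, hg, if_pos hsT]
    intro t ht a b
    rcases le_total t T with htT | htT
    · rw [hV1 htT]; exact hfirst ht.1 htT a b
    have hint1 : IntervalIntegrable
        (fun s => (-Complex.I) * (((H₀ + (g s : ℂ) • H₁) * V s) a b)) volume 0 T := by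
      refine (intervalIntegrable_schrodinger H₀ H₁ hf hC hT hUc a b).congr_uIoo fun s hs => ?_
      rw [uIoo_of_le hT] at hs
      simp only [hV1 hs.2.le, hg, if_pos hs.2.le]
    -- The control may jump at `T`, so the integrands are compared on the open interval only.
    have hcongr : EqOn (fun s => (A * (exp ((s - T) • A) * U T)) a b)
        (fun s => (-Complex.I) * (((H₀ + (g s : ℂ) • H₁) * V s) a b)) (uIoo T t) := by
      intro s hs
      rw [uIoo_of_le htT] at hs
      simp only [hA, generator_mul_apply, hV2 hs.1.le, hg, if_neg (not_le.2 hs.1)]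
    have hcont : Continuous fun s => (A * (exp ((s - T) • A) * U T)) a b := by
      refine Continuous.matrix_elem (continuous_const.mul (Continuous.mul ?_ continuous_const)) a b
      exact (continuous_exp_smul A).comp (by fun_prop)
    have hint2' : IntervalIntegrable (fun s => (A * (exp ((s - T) • A) * U T)) a b)
      volume T t := hcont.intervalIntegrable _ _
    have hderiv (s : ℝ) : HasDerivAt (fun s => (exp ((s - T) • A) * U T) a b)
        ((A * (exp ((s - T) • A) * U T)) a b) s := by
      refine hasDerivAt_entry ?_ a b
      have h1 := (hasDerivAt_exp_smul A (s - T)).comp_sub_const s T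
      simpa [mul_assoc] using h1.mul_const (U T)
    rw [← intervalIntegral.integral_add_adjacent_intervals hint1 (hint2'.congr_uIoo hcongr),
      ← add_assoc, ← hfirst hT le_rfl, ← intervalIntegral.integral_congr_uIoo hcongr,
      intervalIntegral.integral_eq_sub_of_hasDerivAt (fun s _ => hderiv s) hint2', hV2 htT]
    simp
  · rw [hV2 (by linarith)]; simp

lemma reachable_of_mem_evolutionSemigroup {H₀ H₁ W : Matrix ι ι ℂ}
    (hW : W ∈ evolutionSemigroup H₀ H₁) : Reachable H₀ H₁ W := by
  refine Submonoid.closure_induction_left (motive := fun X _ => Reachable H₀ H₁ X)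
    (reachable_one H₀ H₁) ?_ hW
  rintro _ ⟨t, ht, c, rfl⟩ Y _ hY
  exact reachable_exp_mul hY ht c

/-! ### Conjugates of the generators span the Lie algebra -/

lemma star_generator {H₀ H₁ : Matrix ι ι ℂ} (h₀ : H₀ᴴ = H₀) (h₁ : H₁ᴴ = H₁) (c : ℝ) :
    star (generator H₀ H₁ c) = -generator H₀ H₁ c := by
  rw [star_eq_conjTranspose, generator, conjTranspose_smul, conjTranspose_add, conjTranspose_smul,
    h₀, h₁]
  simp [add_comm]

lemma exp_mem_unitary {A : Matrix ι ι ℂ} (hA : star A = -A) :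
    exp A ∈ unitary (Matrix ι ι ℂ) :=
  letI : NormedAlgebra ℚ (Matrix ι ι ℂ) := .restrictScalars ℚ ℂ _
  exp_mem_unitary_of_mem_skewAdjoint (skewAdjoint.mem_iff.2 hA)

lemma star_exp_smul {A : Matrix ι ι ℂ} (hA : star A = -A) (t : ℝ) :
    star (exp (t • A)) = exp (t • (-A)) := by
  rw [star_exp, star_smul, hA, star_trivial]

lemma evolutionSemigroup_le_unitary {H₀ H₁ : Matrix ι ι ℂ} (h₀ : H₀ᴴ = H₀) (h₁ : H₁ᴴ = H₁) :
    evolutionSemigroup H₀ H₁ ≤ unitary (Matrix ι ι ℂ) := by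
  refine Submonoid.closure_le.2 ?_
  rintro _ ⟨t, -, c, rfl⟩
  exact exp_mem_unitary (by rw [star_smul, star_generator h₀ h₁, star_trivial, smul_neg])

/-- The span of the conjugates of the generators by the evolution operators. -/
def conjugateSpan (H₀ H₁ : Matrix ι ι ℂ) : Submodule ℝ (Matrix ι ι ℂ) :=
  Submodule.span ℝ {X | ∃ s ∈ evolutionSemigroup H₀ H₁, ∃ c : ℝ,
    X = s * generator H₀ H₁ c * star s}

lemma generator_mem_conjugateSpan (H₀ H₁ : Matrix ι ι ℂ) (c : ℝ) :
    generator H₀ H₁ c ∈ conjugateSpan H₀ H₁ :=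
  Submodule.subset_span ⟨1, one_mem _, c, by simp⟩

lemma conj_mem_conjugateSpan {H₀ H₁ s X : Matrix ι ι ℂ} (hs : s ∈ evolutionSemigroup H₀ H₁)
    (hX : X ∈ conjugateSpan H₀ H₁) : s * X * star s ∈ conjugateSpan H₀ H₁ := by
  induction hX using Submodule.span_induction with
  | mem X hX =>
    obtain ⟨r, hr, c, rfl⟩ := hX
    exact Submodule.subset_span ⟨s * r, mul_mem hs hr, c, by simp [mul_assoc]⟩
  | zero => simp
  | add X Y _ _ hX hY => rw [mul_add, add_mul]; exact add_mem hX hY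
  | smul c X _ hX =>
    rw [mul_smul_comm, smul_mul_assoc]; exact Submodule.smul_mem _ c hX

/-- The derivative is a limit of right difference quotients, and a finite-dimensional subspace is
closed. Nonnegative times suffice, which matters because evolutions cannot be run backwards. -/
lemma deriv_mem_of_forall_nonneg_mem {V : Type*} [NormedAddCommGroup V] [NormedSpace ℝ V]
    [FiniteDimensional ℝ V] {M : Submodule ℝ V} {γ : ℝ → V} {γ' : V} (h : HasDerivAt γ γ' 0)
    (hM : ∀ t, 0 ≤ t → γ t ∈ M) : γ' ∈ M := by
  have hcl : IsClosed (M : Set V) := M.closed_of_finiteDimensional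
  have hlim := (hasDerivWithinAt_iff_tendsto_slope.1 (h.hasDerivWithinAt (s := Ioi 0)))
  rw [sdiff_singleton_eq_self (by simp)] at hlim
  refine hcl.mem_of_tendsto hlim ?_
  filter_upwards [self_mem_nhdsWithin] with t ht
  rw [slope_def_module]
  exact M.smul_mem _ (M.sub_mem (hM t (le_of_lt ht)) (hM 0 le_rfl))

lemma lie_generator_mem_conjugateSpan {H₀ H₁ X : Matrix ι ι ℂ} (h₀ : H₀ᴴ = H₀) (h₁ : H₁ᴴ = H₁)
    (c : ℝ) (hX : X ∈ conjugateSpan H₀ H₁) :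
    ⁅generator H₀ H₁ c, X⁆ ∈ conjugateSpan H₀ H₁ := by
  set A := generator H₀ H₁ c with hA
  have hstar : star A = -A := star_generator h₀ h₁ c
  have hd : HasDerivAt (fun t : ℝ => exp (t • A) * X * exp (t • (-A))) ⁅A, X⁆ 0 := by
    have := ((hasDerivAt_exp_smul A 0).mul_const X).mul (hasDerivAt_exp_smul (-A) 0)
    convert! this using 1
    simp [Ring.lie_def, sub_eq_add_neg]
  refine deriv_mem_of_forall_nonneg_mem hd fun t ht => ?_
  rw [← star_exp_smul hstar]
  exact conj_mem_conjugateSpan (exp_smul_generator_mem H₀ H₁ ht c) hX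

lemma lieSpan_le_conjugateSpan {H₀ H₁ : Matrix ι ι ℂ} (h₀ : H₀ᴴ = H₀) (h₁ : H₁ᴴ = H₁) :
    (LieSubalgebra.lieSpan ℝ (Matrix ι ι ℂ) {Complex.I • H₀, Complex.I • H₁}).toSubmodule ≤
      conjugateSpan H₀ H₁ := by
  -- `K` consists of the elements of the span whose brackets preserve the span; the Jacobi identity
  -- makes it a Lie subalgebra.
  let K : LieSubalgebra ℝ (Matrix ι ι ℂ) :=
    { carrier := {X | X ∈ conjugateSpan H₀ H₁ ∧
        ∀ Y ∈ conjugateSpan H₀ H₁, ⁅X, Y⁆ ∈ conjugateSpan H₀ H₁}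
      add_mem' := fun hX hY => ⟨add_mem hX.1 hY.1, fun Z hZ => by
        rw [add_lie]; exact add_mem (hX.2 Z hZ) (hY.2 Z hZ)⟩
      zero_mem' := ⟨zero_mem _, fun Z _ => by rw [zero_lie]; exact zero_mem _⟩
      smul_mem' := fun c X hX => ⟨Submodule.smul_mem _ c hX.1, fun Z hZ => by
        rw [smul_lie]; exact Submodule.smul_mem _ c (hX.2 Z hZ)⟩
      lie_mem' := fun {X Y} hX hY => ⟨hX.2 Y hY.1, fun Z hZ => by
        rw [lie_lie]; exact sub_mem (hX.2 _ (hY.2 Z hZ)) (hY.2 _ (hX.2 Z hZ))⟩ }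
  have hgen (c : ℝ) : generator H₀ H₁ c ∈ K :=
    ⟨generator_mem_conjugateSpan H₀ H₁ c, fun Y hY =>
      lie_generator_mem_conjugateSpan h₀ h₁ c hY⟩
  have hle : LieSubalgebra.lieSpan ℝ (Matrix ι ι ℂ) {Complex.I • H₀, Complex.I • H₁} ≤ K := by
    refine LieSubalgebra.lieSpan_le.2 ?_
    rintro _ (rfl | rfl)
    · have : Complex.I • H₀ = -generator H₀ H₁ 0 := by simp [generator]
      rw [this]
      exact K.neg_mem (hgen 0)
    · have : Complex.I • H₁ = generator H₀ H₁ 0 - generator H₀ H₁ 1 := by simp [generator]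
      rw [this]
      exact K.sub_mem (hgen 0) (hgen 1)
  exact fun X hX => (hle hX).1

/-! ### Families of maximal rank and interior points -/

/-- `S` contains the image of a family, strictly differentiable at a point over `g`, whose
derivative covers the directions `X * g` with `X ∈ R`. -/
def HasTangent (S : Set (Matrix ι ι ℂ)) (g : Matrix ι ι ℂ)
    (R : Submodule ℝ (Matrix ι ι ℂ)) : Prop :=
  ∃ (V : Type) (_ : NormedAddCommGroup V) (_ : NormedSpace ℝ V) (_ : CompleteSpace V)
    (F : V → Matrix ι ι ℂ) (F' : V →L[ℝ] Matrix ι ι ℂ) (v : V),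
    HasStrictFDerivAt F F' v ∧ F v = g ∧ (∀ᶠ w in 𝓝 v, F w ∈ S) ∧ ∀ X ∈ R, ∃ w, F' w = X * g

lemma HasTangent.mem {S : Set (Matrix ι ι ℂ)} {g : Matrix ι ι ℂ}
    {R : Submodule ℝ (Matrix ι ι ℂ)} (h : HasTangent S g R) : g ∈ S := by
  obtain ⟨V, _, _, _, F, F', v, -, rfl, hS, -⟩ := h
  exact hS.self_of_nhds

lemma hasTangent_one_bot (S : Submonoid (Matrix ι ι ℂ)) : HasTangent (S : Set (Matrix ι ι ℂ)) 1 ⊥ := by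
  refine ⟨ℝ, inferInstance, inferInstance, inferInstance, fun _ => 1, 0, 0,
    hasStrictFDerivAt_const _ _, rfl, Eventually.of_forall fun _ => one_mem S, ?_⟩
  intro X hX
  rw [(Submodule.mem_bot ℝ).1 hX]
  exact ⟨0, by simp⟩

/-- One more time parameter is appended, based at time 1 so that nearby times stay positive. Its
derivative `g * s * A * exp A` is the new direction times the new base point, while right
multiplication keeps the old directions. -/
lemma HasTangent.extend {S : Submonoid (Matrix ι ι ℂ)} {g s A : Matrix ι ι ℂ}
    {R : Submodule ℝ (Matrix ι ι ℂ)} (h : HasTangent (S : Set (Matrix ι ι ℂ)) g R)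
    (hu : S ≤ unitary (Matrix ι ι ℂ)) (hs : s ∈ S)
    (hA : ∀ t : ℝ, 0 ≤ t → exp (t • A) ∈ S) :
    HasTangent (S : Set (Matrix ι ι ℂ)) (g * s * exp ((1 : ℝ) • A))
      (R ⊔ Submodule.span ℝ {g * s * A * star (g * s)}) := by
  have hgs : star (g * s) * (g * s) = 1 := (hu (mul_mem h.mem hs)).1
  obtain ⟨V, _, _, _, F, F', v, hF, rfl, hS, hR⟩ := h
  have h1 : HasStrictFDerivAt (fun p : V × ℝ => F p.1 * s)
      (_ : V × ℝ →L[ℝ] Matrix ι ι ℂ) (v, (1 : ℝ)) :=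
    (hF.comp (v, (1 : ℝ)) (hasStrictFDerivAt_fst)).mul_const' s
  have h2 : HasStrictFDerivAt (fun p : V × ℝ => exp (p.2 • A))
      (_ : V × ℝ →L[ℝ] Matrix ι ι ℂ) (v, (1 : ℝ)) :=
    HasStrictFDerivAt.comp (g := fun t : ℝ => exp (t • A)) (v, (1 : ℝ))
      (hasStrictDerivAt_exp_smul_const' A (1 : ℝ)).hasStrictFDerivAt hasStrictFDerivAt_snd
  refine ⟨V × ℝ, inferInstance, inferInstance, inferInstance,
    fun p => F p.1 * s * exp (p.2 • A), _, (v, 1), h1.mul' h2, rfl, ?_, ?_⟩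
  · have e1 : ∀ᶠ p : V × ℝ in 𝓝 (v, 1), F p.1 ∈ S := by
      rw [nhds_prod_eq]; exact tendsto_fst.eventually hS
    have e2 : ∀ᶠ p : V × ℝ in 𝓝 (v, 1), 0 < p.2 := by
      rw [nhds_prod_eq]; exact tendsto_snd.eventually (lt_mem_nhds one_pos)
    filter_upwards [e1, e2] with p hp1 hp2
    exact mul_mem (mul_mem hp1 hs) (hA _ hp2.le)
  · intro X hX
    obtain ⟨Y, hY, Z, hZ, rfl⟩ := Submodule.mem_sup.1 hX
    obtain ⟨r, rfl⟩ := Submodule.mem_span_singleton.1 hZ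
    obtain ⟨w, hw⟩ := hR Y hY
    refine ⟨(w, r), ?_⟩
    simp [hw, add_mul, mul_assoc]
    have hcancel : star s * (star (F v) * (F v * (s * exp A))) = exp A := by
      have := congrArg (· * exp A) hgs
      simpa [mul_assoc] using this
    rw [hcancel, add_comm]

lemma exists_hasTangent_lieSpan {H₀ H₁ : Matrix ι ι ℂ} (h₀ : H₀ᴴ = H₀) (h₁ : H₁ᴴ = H₁)
    {R₀ : Submodule ℝ (Matrix ι ι ℂ)} (hR₀ : R₀ ≤ conjugateSpan H₀ H₁)
    (hconj : ∀ u ∈ unitary (Matrix ι ι ℂ), ∀ X ∈ R₀, star u * X * u ∈ R₀) :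
    ∃ g, HasTangent (evolutionSemigroup H₀ H₁ : Set (Matrix ι ι ℂ)) g R₀ := by
  set S := evolutionSemigroup H₀ H₁ with hSdef
  have hu := evolutionSemigroup_le_unitary h₀ h₁
  -- At a family of maximal dimension no extension adds a direction, so `R` already contains every
  -- conjugate of a generator.
  let D : Set ℕ := {n | ∃ g R, HasTangent (S : Set (Matrix ι ι ℂ)) g R ∧ Module.finrank ℝ R = n}
  have hne : D.Nonempty := ⟨_, 1, ⊥, hasTangent_one_bot S, rfl⟩
  have hbd : BddAbove D := ⟨Module.finrank ℝ (Matrix ι ι ℂ), by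
    rintro _ ⟨g, R, -, rfl⟩; exact Submodule.finrank_le R⟩
  obtain ⟨g, R, hgR, hfin⟩ := Nat.sSup_mem hne hbd
  have hg := hu hgR.mem
  have hmem : ∀ s ∈ S, ∀ c, g * s * generator H₀ H₁ c * star (g * s) ∈ R := by
    intro s hs c
    have hext := hgR.extend hu hs (fun t ht => exp_smul_generator_mem H₀ H₁ ht c)
    have hle := le_csSup hbd ⟨_, _, hext, rfl⟩
    rw [← hfin] at hle
    have heq := Submodule.eq_of_le_of_finrank_le (le_sup_left (a := R)
      (b := Submodule.span ℝ {g * s * generator H₀ H₁ c * star (g * s)})) hle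
    rw [heq]
    exact Submodule.mem_sup_right (Submodule.mem_span_singleton_self _)
  have hspan : ∀ X ∈ conjugateSpan H₀ H₁, g * X * star g ∈ R := by
    intro X hX
    induction hX using Submodule.span_induction with
    | mem X hX =>
      obtain ⟨r, hr, c, rfl⟩ := hX
      simpa [mul_assoc] using hmem r hr c
    | zero => simp
    | add X Y _ _ hX hY => rw [mul_add, add_mul]; exact add_mem hX hY
    | smul c X _ hX => rw [mul_smul_comm, smul_mul_assoc]; exact Submodule.smul_mem _ c hX
  have hle : R₀ ≤ R := by
    intro X hX
    have h := hspan _ (hR₀ (hconj g hg X hX))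
    have e : g * (star g * X * g) * star g = X := by
      calc g * (star g * X * g) * star g = (g * star g) * X * (g * star g) := by noncomm_ring
        _ = X := by rw [hg.2]; simp
    rwa [e] at h
  obtain ⟨V, i1, i2, i3, F, F', v, hF, hv, hS, hR⟩ := hgR
  exact ⟨g, V, i1, i2, i3, F, F', v, hF, hv, hS, fun X hX => hR X (hle hX)⟩

/-- Unitarity gives `2 Y = -Y²`, hence `2 ‖Y‖ ≤ ‖Y‖²`, which forces `Y = 0` when the norm is below
1. -/
lemma eq_one_of_unitary_of_star_eq {Y : Matrix ι ι ℂ} (hY : star Y = Y) (hnorm : ‖Y‖ < 1)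
    (hu : 1 + Y ∈ unitary (Matrix ι ι ℂ)) : Y = 0 := by
  have h := hu.1
  rw [star_add, star_one, hY] at h
  have h2 : (2 : ℝ) • Y = -(Y * Y) := by
    rw [two_smul, eq_neg_iff_add_eq_zero]
    calc Y + Y + Y * Y = (1 + Y) * (1 + Y) - 1 := by noncomm_ring
      _ = 0 := by rw [h, sub_self]
  have h3 : 2 * ‖Y‖ ≤ ‖Y‖ * ‖Y‖ := by
    calc 2 * ‖Y‖ = ‖(2 : ℝ) • Y‖ := by rw [norm_smul]; simp
      _ = ‖Y * Y‖ := by rw [h2, norm_neg]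
      _ ≤ ‖Y‖ * ‖Y‖ := norm_mul_le _ _
  have h4 := norm_nonneg Y
  exact norm_eq_zero.1 (by nlinarith)

/-- A family of unitary matrices whose derivative covers all skew-Hermitian directions covers
a neighbourhood in the unitary group. -/
lemma eventually_mem_image {V : Type} [NormedAddCommGroup V] [NormedSpace ℝ V] [CompleteSpace V]
    {F : V → Matrix ι ι ℂ} {F' : V →L[ℝ] Matrix ι ι ℂ} {v₀ : V} (hF : HasStrictFDerivAt F F' v₀)
    (hR : ∀ X, star X = -X → ∃ w, F' w = X * F v₀) {P : V → Prop} (hP : ∀ᶠ v in 𝓝 v₀, P v)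
    (hu : ∀ v, P v → F v ∈ unitary (Matrix ι ι ℂ)) :
    ∀ᶠ W in 𝓝 (F v₀), W ∈ unitary (Matrix ι ι ℂ) → ∃ v, P v ∧ F v = W := by
  -- The factor `1 + Z + star Z` supplies the Hermitian directions missing from `F`, so the combined
  -- map is open onto all matrices. At a nearby unitary value this factor is unitary and
  -- self-adjoint, hence equal to 1.
  let φ : Matrix ι ι ℂ →ₗ[ℝ] Matrix ι ι ℂ :=
    { toFun := fun Z => Z + star Z
      map_add' := fun X Y => by rw [star_add]; abel
      map_smul' := fun c X => by simp }
  let ψ := LinearMap.toContinuousLinearMap φ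
  have hψ (Z : Matrix ι ι ℂ) : ψ Z = Z + star Z := rfl
  have h1 : HasStrictFDerivAt (fun p : V × Matrix ι ι ℂ => 1 + ψ p.2)
      (ψ ∘L ContinuousLinearMap.snd ℝ V (Matrix ι ι ℂ)) (v₀, 0) :=
    ((ψ ∘L ContinuousLinearMap.snd ℝ V (Matrix ι ι ℂ)).hasStrictFDerivAt).const_add 1
  have h2 : HasStrictFDerivAt (fun p : V × Matrix ι ι ℂ => F p.1)
      (F' ∘L ContinuousLinearMap.fst ℝ V (Matrix ι ι ℂ)) (v₀, 0) :=
    HasStrictFDerivAt.comp (g := F) (v₀, (0 : Matrix ι ι ℂ)) hF hasStrictFDerivAt_fst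
  have h3 := h1.mul' h2
  have hg := hu v₀ hP.self_of_nhds
  have hmap : map (fun p : V × Matrix ι ι ℂ => (1 + ψ p.2) * F p.1) (𝓝 (v₀, 0)) =
      𝓝 ((1 + ψ 0) * F v₀) := h3.map_nhds_eq_of_surj (by
    rw [LinearMap.range_eq_top]
    intro M
    set X := M * star (F v₀) with hX
    obtain ⟨w, hw⟩ := hR ((2⁻¹ : ℝ) • (X - star X)) (by
      rw [star_smul, star_sub, star_star, star_trivial, ← smul_neg, neg_sub])
    refine ⟨(w, (2⁻¹ : ℝ) • X), ?_⟩
    have hM : X * F v₀ = M := by rw [hX, mul_assoc, hg.1, mul_one]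
    have hs : (2⁻¹ : ℝ) • (X - star X) + ((2⁻¹ : ℝ) • X + star ((2⁻¹ : ℝ) • X)) = X := by
      rw [star_smul, star_trivial (2⁻¹ : ℝ)]; module
    have hs' := congrArg (· * F v₀) hs
    simp only [add_mul, hM] at hs'
    simpa [hw, hψ, add_mul] using hs')
  have hnhds : ∀ᶠ p : V × Matrix ι ι ℂ in 𝓝 (v₀, 0), P p.1 ∧ ‖ψ p.2‖ < 1 := by
    have e1 : ∀ᶠ p : V × Matrix ι ι ℂ in 𝓝 (v₀, 0), P p.1 := by
      rw [nhds_prod_eq]; exact tendsto_fst.eventually hP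
    have hc : Continuous fun p : V × Matrix ι ι ℂ => ‖ψ p.2‖ := by fun_prop
    have e2 : ∀ᶠ p : V × Matrix ι ι ℂ in 𝓝 (v₀, 0), ‖ψ p.2‖ < 1 :=
      hc.continuousAt.eventually_lt continuousAt_const (by simp)
    exact e1.and e2
  have himg := image_mem_map (m := fun p : V × Matrix ι ι ℂ => (1 + ψ p.2) * F p.1) hnhds
  rw [hmap] at himg
  simp only [map_zero, add_zero, one_mul] at himg
  filter_upwards [himg] with W hW hWu
  obtain ⟨⟨v, Z⟩, ⟨hv, hZ⟩, rfl⟩ := hW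
  simp only at hv hZ hWu ⊢
  have hFv := hu v hv
  have h1Z : 1 + ψ Z ∈ unitary (Matrix ι ι ℂ) := by
    have := mul_mem hWu (Unitary.star_mem hFv)
    rwa [mul_assoc, hFv.2, mul_one] at this
  have h0 := eq_one_of_unitary_of_star_eq (Y := ψ Z)
    (by rw [hψ, star_add, star_star, add_comm]) hZ h1Z
  exact ⟨v, hv, by simp [h0]⟩

/-! ### Recurrence of powers and neighbourhoods of the identity -/

instance compactSpace_unitary : CompactSpace (unitary (Matrix ι ι ℂ)) := by
  have : ProperSpace (Matrix ι ι ℂ) := FiniteDimensional.proper ℝ _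
  refine isCompact_iff_compactSpace.1 (Metric.isCompact_of_isClosed_isBounded ?_ ?_)
  · have : (unitary (Matrix ι ι ℂ) : Set (Matrix ι ι ℂ)) =
        {U | star U * U = 1} ∩ {U | U * star U = 1} := rfl
    rw [this]
    exact (isClosed_eq (by fun_prop) continuous_const).inter
      (isClosed_eq (by fun_prop) continuous_const)
  · refine Metric.isBounded_closedBall (x := (0 : Matrix ι ι ℂ)) (r := 1) |>.subset fun U hU => ?_
    rw [mem_closedBall_zero_iff]
    rcases subsingleton_or_nontrivial (Matrix ι ι ℂ) with h | h
    · rw [Subsingleton.elim U 0, norm_zero]; exact zero_le_one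
    · exact (CStarRing.norm_of_mem_unitary hU).le

lemma exists_pow_eventually {U : Matrix ι ι ℂ} (hU : U ∈ unitary (Matrix ι ι ℂ))
    {P : Matrix ι ι ℂ → Prop} (hP : ∀ᶠ X in 𝓝 1, P X) : ∃ k : ℕ, 1 ≤ k ∧ P (U ^ k) := by
  have h := mapClusterPt_one_atTop_pow (⟨U, hU⟩ : unitary (Matrix ι ι ℂ))
  have hP' : ∀ᶠ X : unitary (Matrix ι ι ℂ) in 𝓝 1, P X :=
    continuous_subtype_val.continuousAt.eventually hP
  obtain ⟨k, hk, hk'⟩ := ((h.frequently hP').and_eventually (eventually_ge_atTop 1)).exists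
  exact ⟨k, hk', hk⟩

/-- A subsemigroup of a group of unitary matrices with an interior point is a neighbourhood of
the identity. -/
lemma eventually_one_mem {S G : Submonoid (Matrix ι ι ℂ)} (hG : G ≤ unitary (Matrix ι ι ℂ))
    (hstar : ∀ X ∈ G, star X ∈ G) (hSG : S ≤ G) {g : Matrix ι ι ℂ} (hg : g ∈ S)
    (hint : ∀ᶠ W in 𝓝 g, W ∈ G → W ∈ S) : ∀ᶠ W in 𝓝 1, W ∈ G → W ∈ S := by
  have hc : ContinuousAt (fun p : Matrix ι ι ℂ × Matrix ι ι ℂ => p.1 * g * star p.2) (1, 1) := by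
    fun_prop
  have hev : ∀ᶠ p : Matrix ι ι ℂ × Matrix ι ι ℂ in 𝓝 (1, 1),
      p.1 * g * star p.2 ∈ G → p.1 * g * star p.2 ∈ S :=
    hc.eventually (by simpa using hint)
  rw [nhds_prod_eq] at hev
  obtain ⟨pa, ha, pb, hb, hab⟩ := eventually_prod_iff.1 hev
  -- With `g ^ k` near 1, the product `Z * g * star (g ^ k)` is near `g`, hence in `S`. Multiplying
  -- by `g ^ (k - 1)` recovers `Z` without inverting inside `S`.
  obtain ⟨k, hk, hpk⟩ := exists_pow_eventually (hG (hSG hg)) hb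
  filter_upwards [ha] with Z hZ hZG
  have hmem := hab hZ hpk
    (mul_mem (mul_mem hZG (hSG hg)) (hstar _ (pow_mem (hSG hg) k)))
  have := mul_mem hmem (pow_mem hg (k - 1))
  have hgk : star (g ^ k) * g ^ k = 1 := (hG (pow_mem (hSG hg) k)).1
  have e : Z * g * star (g ^ k) * g ^ (k - 1) = Z := by
    have hcomm : g * star (g ^ k) = star (g ^ k) * g := by
      have hgg : g * star g = star g * g := by rw [(hG (hSG hg)).1, (hG (hSG hg)).2]
      rw [star_pow]
      exact (Commute.pow_right hgg k)
    calc Z * g * star (g ^ k) * g ^ (k - 1) = Z * (g * star (g ^ k)) * g ^ (k - 1) := by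
          simp only [mul_assoc]
      _ = Z * star (g ^ k) * (g * g ^ (k - 1)) := by rw [hcomm]; simp only [mul_assoc]
      _ = Z := by
        rw [← pow_succ', Nat.sub_add_cancel hk, mul_assoc, hgk, mul_one]
  rwa [e] at this

lemma exp_mem_of_eventually {S G : Submonoid (Matrix ι ι ℂ)}
    (hone : ∀ᶠ W in 𝓝 1, W ∈ G → W ∈ S) {X : Matrix ι ι ℂ}
    (hX : ∀ t : ℝ, exp (t • X) ∈ G) : exp X ∈ S := by
  have hlim : Tendsto (fun n : ℕ => exp (((n : ℝ) + 1)⁻¹ • X)) atTop (𝓝 1) := by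
    have h0 : Tendsto (fun n : ℕ => ((n : ℝ) + 1)⁻¹) atTop (𝓝 0) := by
      simpa using tendsto_one_div_add_atTop_nhds_zero_nat (𝕜 := ℝ)
    have := (continuous_exp_smul X).continuousAt (x := (0 : ℝ)) |>.tendsto.comp h0
    simpa [Function.comp_def] using this
  obtain ⟨n, hn⟩ := (hlim.eventually hone).exists
  have hmem := pow_mem (hn (hX _)) (n + 1)
  have e : exp (((n : ℝ) + 1)⁻¹ • X) ^ (n + 1) = exp X := by
    rw [← Matrix.exp_nsmul, ← Nat.cast_smul_eq_nsmul ℝ, smul_smul]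
    have : ((n : ℝ) + 1) ≠ 0 := by positivity
    push_cast
    rw [mul_inv_cancel₀ this, one_smul]
  rwa [e] at hmem

/-! ### Logarithms of unitary and special unitary matrices -/

lemma exp_conj_diagonal {U : Matrix ι ι ℂ} (hU : U ∈ unitary (Matrix ι ι ℂ)) (v : ι → ℂ) :
    exp (U * diagonal v * star U) = U * diagonal (fun i => Complex.exp (v i)) * star U := by
  have h := Matrix.exp_units_conj (Unitary.toUnits ⟨U, hU⟩) (diagonal v)
  rw [Matrix.exp_diagonal] at h
  have e : exp v = fun i => Complex.exp (v i) := by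
    ext i; rw [Pi.coe_exp, Complex.exp_eq_exp_ℂ]
  rw [e] at h
  exact h

lemma exists_diagonalization {H : Matrix ι ι ℂ} (hH : Hᴴ = H) :
    ∃ U ∈ unitary (Matrix ι ι ℂ), ∃ e : ι → ℝ,
      Complex.I • H = U * diagonal (fun i => Complex.I * e i) * star U := by
  have hH' : H.IsHermitian := hH
  refine ⟨hH'.eigenvectorUnitary, hH'.eigenvectorUnitary.2, hH'.eigenvalues, ?_⟩
  have e : diagonal (fun i => Complex.I * (hH'.eigenvalues i : ℂ)) =
      Complex.I • diagonal (RCLike.ofReal ∘ hH'.eigenvalues : ι → ℂ) := by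
    rw [← diagonal_smul]; rfl
  conv_lhs => rw [hH'.spectral_theorem]
  rw [e, mul_smul_comm, smul_mul_assoc]
  rfl

lemma det_conj_unitary {U : Matrix ι ι ℂ} (hU : U ∈ unitary (Matrix ι ι ℂ)) (M : Matrix ι ι ℂ) :
    (U * M * star U).det = M.det := by
  rw [det_mul_right_comm, hU.2, one_mul]

lemma trace_conj_unitary {U : Matrix ι ι ℂ} (hU : U ∈ unitary (Matrix ι ι ℂ))
    (M : Matrix ι ι ℂ) : (U * M * star U).trace = M.trace := by
  rw [trace_mul_cycle, hU.1, one_mul]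

lemma det_exp_I_smul {H : Matrix ι ι ℂ} (hH : Hᴴ = H) :
    (exp (Complex.I • H)).det = Complex.exp (Complex.I • H).trace := by
  obtain ⟨U, hU, e, he⟩ := exists_diagonalization hH
  rw [he, exp_conj_diagonal hU, det_conj_unitary hU, trace_conj_unitary hU, det_diagonal,
    trace_diagonal, Complex.exp_sum]

lemma exists_eq_exp_I_smul {W : Matrix ι ι ℂ} (hW : W ∈ unitary (Matrix ι ι ℂ)) :
    ∃ H : Matrix ι ι ℂ, Hᴴ = H ∧ exp (Complex.I • H) = W := by
  refine ⟨_, IsSelfAdjoint.cfc_arg W, ?_⟩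
  have hfin : (spectrum ℂ W).Finite := Matrix.finite_spectrum W
  -- `arg` jumps on the negative axis, but any function is continuous on a finite spectrum.
  have hcont : ContinuousOn (Complex.ofReal ∘ Complex.arg) (spectrum ℂ W) := hfin.continuousOn _
  have hn : IsStarNormal W := ⟨by rw [Commute, SemiconjBy, hW.1, hW.2]⟩
  rw [← CFC.exp_eq_normedSpace_exp (𝕜 := ℂ) (by cfc_tac),
    ← cfc_comp_smul .., ← cfc_comp' ..]
  conv_rhs => rw [← cfc_id' ℂ W]
  refine cfc_congr fun y hy => ?_
  have hy₁ : ‖y‖ = 1 := spectrum.norm_eq_one_of_unitary hW hy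
  have hlog : Complex.I * y.arg = Complex.log y :=
    Complex.ext (by simp [Complex.log_re, hy₁]) (by simp [Complex.log_im])
  have hy₀ : y ≠ 0 := by rintro rfl; simp at hy₁
  simpa [← Complex.exp_eq_exp_ℂ, hlog] using Complex.exp_log hy₀

lemma exists_eq_exp_of_mem_specialUnitary {W : Matrix ι ι ℂ}
    (hW : W ∈ specialUnitaryGroup ι ℂ) :
    ∃ X ∈ specialUnitaryLieAlgebra ι, exp X = W := by
  obtain ⟨hWu, hdet⟩ := mem_specialUnitaryGroup_iff.1 hW
  obtain ⟨H, hH, rfl⟩ := exists_eq_exp_I_smul hWu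
  rw [det_exp_I_smul hH] at hdet
  obtain ⟨U, hU, e, he⟩ := exists_diagonalization hH
  rcases isEmpty_or_nonempty ι with hι | ⟨⟨i₀⟩⟩
  · exact ⟨Complex.I • H, ⟨conjTranspose_I_smul hH, by simp [trace]⟩, rfl⟩
  rw [he, trace_conj_unitary hU, trace_diagonal] at hdet
  obtain ⟨k, hk⟩ := Complex.exp_eq_one_iff.1 hdet
  -- The eigenvalues sum to `2πk`; subtracting this from one of them makes the trace vanish without
  -- changing the exponential.
  set e' : ι → ℝ := fun i => e i - if i = i₀ then 2 * Real.pi * k else 0 with he'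
  have hexp : (fun i => Complex.exp (Complex.I * (e' i : ℂ))) =
      fun i => Complex.exp (Complex.I * e i) := by
    ext i
    simp only [he']
    split_ifs
    · rw [Complex.exp_eq_exp_iff_exists_int]
      exact ⟨-k, by push_cast; ring⟩
    · simp
  refine ⟨U * diagonal (fun i => Complex.I * (e' i : ℂ)) * star U, ⟨?_, ?_⟩, ?_⟩
  · rw [← star_eq_conjTranspose, star_mul, star_mul, star_star, star_eq_conjTranspose (diagonal _),
      diagonal_conjTranspose, ← mul_assoc, ← neg_mul, ← mul_neg, diagonal_neg]
    congr 3
    funext i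
    rw [Pi.star_apply, star_mul', Complex.star_def, Complex.conj_I, Complex.conj_ofReal,
      neg_mul]
  · rw [trace_conj_unitary hU, trace_diagonal]
    have hsum : ∑ i, e' i = ∑ i, e i - 2 * Real.pi * k := by
      simp [he', Finset.sum_sub_distrib]
    rw [← Finset.mul_sum] at hk ⊢
    have hsum' := congrArg Complex.ofReal hsum
    push_cast at hsum'
    rw [hsum', mul_sub, hk]
    ring
  · rw [exp_conj_diagonal hU, hexp, he, exp_conj_diagonal hU]

lemma exists_eq_exp_of_mem_unitary {W : Matrix ι ι ℂ} (hW : W ∈ unitaryGroup ι ℂ) :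
    ∃ X ∈ unitaryLieAlgebra ι, exp X = W := by
  obtain ⟨H, hH, rfl⟩ := exists_eq_exp_I_smul hW
  exact ⟨Complex.I • H, conjTranspose_I_smul hH, rfl⟩

lemma exp_mem_specialUnitaryGroup {X : Matrix ι ι ℂ} (hX : X ∈ specialUnitaryLieAlgebra ι) :
    exp X ∈ specialUnitaryGroup ι ℂ := by
  refine mem_specialUnitaryGroup_iff.2 ⟨exp_mem_unitary hX.1, ?_⟩
  have e : Complex.I • ((-Complex.I) • X) = X := by
    rw [smul_smul]; simp
  have hH : ((-Complex.I) • X)ᴴ = (-Complex.I) • X := by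
    rw [conjTranspose_smul, hX.1]; simp
  rw [← e, det_exp_I_smul hH, e, hX.2, Complex.exp_zero]

lemma star_mem_specialUnitaryGroup {X : Matrix ι ι ℂ} (hX : X ∈ specialUnitaryGroup ι ℂ) :
    star X ∈ specialUnitaryGroup ι ℂ := by
  obtain ⟨hXu, hdet⟩ := mem_specialUnitaryGroup_iff.1 hX
  refine mem_specialUnitaryGroup_iff.2 ⟨Unitary.star_mem hXu, ?_⟩
  rw [star_eq_conjTranspose, det_conjTranspose, hdet, star_one]

lemma evolutionSemigroup_le_specialUnitaryGroup {H₀ H₁ : Matrix ι ι ℂ} (h₀ : H₀ᴴ = H₀)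
    (h₁ : H₁ᴴ = H₁) (htr₀ : H₀.trace = 0) (htr₁ : H₁.trace = 0) :
    evolutionSemigroup H₀ H₁ ≤ specialUnitaryGroup ι ℂ := by
  refine Submonoid.closure_le.2 ?_
  rintro _ ⟨t, -, c, rfl⟩
  refine exp_mem_specialUnitaryGroup ((specialUnitaryLieAlgebra ι).smul_mem t
    ⟨star_generator h₀ h₁ c, ?_⟩)
  rw [generator, trace_smul, trace_add, trace_smul, htr₀, htr₁]
  simp

lemma star_mul_mul_skew {u X : Matrix ι ι ℂ} (hX : Xᴴ = -X) :
    (star u * X * u)ᴴ = -(star u * X * u) := by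
  rw [← star_eq_conjTranspose] at hX ⊢
  simp [hX, mul_assoc]

/-! ### Exact controllability on the unitary and special unitary groups -/

/-- If `i H₀` and `i H₁` generate `u(ι)`, every unitary matrix is an evolution operator. -/
theorem mem_evolutionSemigroup_of_lieSpan_eq_unitary {H₀ H₁ : Matrix ι ι ℂ} (h₀ : H₀ᴴ = H₀)
    (h₁ : H₁ᴴ = H₁) (hL : LieSubalgebra.lieSpan ℝ (Matrix ι ι ℂ)
      {Complex.I • H₀, Complex.I • H₁} = unitaryLieAlgebra ι)
    {W : Matrix ι ι ℂ} (hW : W ∈ unitaryGroup ι ℂ) : W ∈ evolutionSemigroup H₀ H₁ := by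
  have hu := evolutionSemigroup_le_unitary h₀ h₁
  have hle := lieSpan_le_conjugateSpan h₀ h₁
  rw [hL] at hle
  obtain ⟨g, hg⟩ := exists_hasTangent_lieSpan h₀ h₁ hle
    fun u _ X hX => star_mul_mul_skew hX
  have hgS := hg.mem
  obtain ⟨V, _, _, _, F, F', v, hF, rfl, hS, hR⟩ := hg
  have hint := eventually_mem_image hF (fun X hX => hR X hX) hS fun w hw => hu hw
  have hone := eventually_one_mem (G := unitary (Matrix ι ι ℂ)) le_rfl
    (fun X hX => Unitary.star_mem hX) hu hgS (hint.mono fun W hW hWG => by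
      obtain ⟨w, hw, rfl⟩ := hW hWG; exact hw)
  obtain ⟨X, hX, rfl⟩ := exists_eq_exp_of_mem_unitary hW
  exact exp_mem_of_eventually hone fun t =>
    exp_mem_unitary ((unitaryLieAlgebra ι).smul_mem t hX)

/-- Among scalar phases near 1, only 1 itself has determinant 1; this removes the auxiliary phase in
the special unitary case. -/
lemma eventually_eq_zero_of_exp_mul_eq_one (n : ℕ) (hn : n ≠ 0) :
    ∀ᶠ θ : ℝ in 𝓝 0, Complex.exp (θ * Complex.I) ^ n = 1 → θ = 0 := by
  have hc : ContinuousAt (fun θ : ℝ => |n * θ|) 0 := by fun_prop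
  filter_upwards [hc.eventually_lt (continuousAt_const (y := 2 * Real.pi))
    (by simpa using Real.pi_pos)] with θ hθ h
  rw [← Complex.exp_nat_mul] at h
  obtain ⟨k, hk⟩ := Complex.exp_eq_one_iff.1 h
  have hk' : (n : ℝ) * θ = k * (2 * Real.pi) := by
    have := congrArg Complex.im hk
    simpa using this
  rw [hk', abs_mul, abs_of_pos Real.two_pi_pos] at hθ
  have hk1 : |(k : ℝ)| < 1 := by
    by_contra hcon
    have := Real.two_pi_pos
    nlinarith [not_lt.1 hcon]
  have hk0 : k = 0 := by
    rw [← Int.abs_lt_one_iff]; exact_mod_cast hk1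
  rw [hk0] at hk'
  simpa [hn] using hk'

/-- If `i H₀` and `i H₁` generate `su(ι)`, every special unitary matrix is an evolution operator. -/
theorem mem_evolutionSemigroup_of_lieSpan_eq_specialUnitary [Nonempty ι] {H₀ H₁ : Matrix ι ι ℂ}
    (h₀ : H₀ᴴ = H₀) (h₁ : H₁ᴴ = H₁) (htr₀ : H₀.trace = 0) (htr₁ : H₁.trace = 0)
    (hL : LieSubalgebra.lieSpan ℝ (Matrix ι ι ℂ)
      {Complex.I • H₀, Complex.I • H₁} = specialUnitaryLieAlgebra ι)
    {W : Matrix ι ι ℂ} (hW : W ∈ specialUnitaryGroup ι ℂ) : W ∈ evolutionSemigroup H₀ H₁ := by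
  have hu := evolutionSemigroup_le_unitary h₀ h₁
  have hsu := evolutionSemigroup_le_specialUnitaryGroup h₀ h₁ htr₀ htr₁
  have hle := lieSpan_le_conjugateSpan h₀ h₁
  rw [hL] at hle
  obtain ⟨g, hg⟩ := exists_hasTangent_lieSpan h₀ h₁ hle
    fun u hu X hX => ⟨star_mul_mul_skew hX.1, by
      rw [trace_mul_cycle, hu.2, one_mul]; exact hX.2⟩
  have hgS := hg.mem
  obtain ⟨V, _, _, _, F, F', v, hF, rfl, hS, hR⟩ := hg
  -- `F` covers only traceless directions. A scalar phase supplies the missing one, so that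
  -- `eventually_mem_image` applies in the full unitary group.
  have hphase : HasStrictFDerivAt (fun p : V × ℝ => exp (p.2 • (Complex.I • (1 : Matrix ι ι ℂ))))
      (_ : V × ℝ →L[ℝ] Matrix ι ι ℂ) (v, (0 : ℝ)) :=
    HasStrictFDerivAt.comp (g := fun t : ℝ => exp (t • (Complex.I • (1 : Matrix ι ι ℂ))))
      (v, (0 : ℝ)) (hasStrictDerivAt_exp_smul_const' _ (0 : ℝ)).hasStrictFDerivAt
      hasStrictFDerivAt_snd
  have hfst : HasStrictFDerivAt (fun p : V × ℝ => F p.1)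
      (F' ∘L ContinuousLinearMap.fst ℝ V ℝ) (v, (0 : ℝ)) :=
    HasStrictFDerivAt.comp (g := F) (v, (0 : ℝ)) hF hasStrictFDerivAt_fst
  have hF₂ := hphase.mul' hfst
  have hexp (t : ℝ) : exp (t • (Complex.I • (1 : Matrix ι ι ℂ))) =
      Complex.exp (t * Complex.I) • (1 : Matrix ι ι ℂ) := by
    have := exp_conj_diagonal (one_mem (unitary (Matrix ι ι ℂ)))
      (fun _ => (t : ℂ) * Complex.I)
    rw [one_mul, star_one, mul_one, one_mul, mul_one, ← smul_one_eq_diagonal,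
      ← smul_one_eq_diagonal] at this
    rw [← this, mul_smul, Complex.coe_smul]
  have hint := eventually_mem_image (P := fun p : V × ℝ => F p.1 ∈ evolutionSemigroup H₀ H₁ ∧
      (Complex.exp (p.2 * Complex.I) ^ Fintype.card ι = 1 → p.2 = 0)) hF₂ ?_ ?_ ?_
  · have hint' : ∀ᶠ W in 𝓝 (F v), W ∈ specialUnitaryGroup ι ℂ →
        W ∈ evolutionSemigroup H₀ H₁ := by
      have e : exp ((0 : ℝ) • (Complex.I • (1 : Matrix ι ι ℂ))) * F v = F v := by simp
      rw [← e]
      refine hint.mono fun W hWi hWG => ?_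
      obtain ⟨hWu, hdet⟩ := mem_specialUnitaryGroup_iff.1 hWG
      obtain ⟨⟨w, θ⟩, ⟨hw, hθ⟩, rfl⟩ := hWi hWu
      simp only at hw hθ
      have hdet' : Complex.exp (θ * Complex.I) ^ Fintype.card ι = 1 := by
        simpa [hexp, (mem_specialUnitaryGroup_iff.1 (hsu hw)).2] using hdet
      simpa [hθ hdet'] using hw
    have hone := eventually_one_mem (G := specialUnitaryGroup ι ℂ)
      (fun X hX => (mem_specialUnitaryGroup_iff.1 hX).1)
      (fun X hX => star_mem_specialUnitaryGroup hX) hsu hgS hint'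
    obtain ⟨X, hX, rfl⟩ := exists_eq_exp_of_mem_specialUnitary hW
    exact exp_mem_of_eventually hone fun t =>
      exp_mem_specialUnitaryGroup ((specialUnitaryLieAlgebra ι).smul_mem t hX)
  · intro X hX
    have hn : (Fintype.card ι : ℂ) ≠ 0 := Nat.cast_ne_zero.2 Fintype.card_ne_zero
    -- The phase direction carries the trace of `X`; the traceless remainder comes from `F`.
    set r : ℝ := X.trace.im / Fintype.card ι with hr
    obtain ⟨w, hw⟩ := hR (X - r • (Complex.I • (1 : Matrix ι ι ℂ))) (by
      refine ⟨(unitaryLieAlgebra ι).sub_mem hX ((unitaryLieAlgebra ι).smul_mem r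
        (conjTranspose_I_smul conjTranspose_one)), ?_⟩
      rw [trace_sub, trace_smul r, trace_smul, trace_one, trace_eq_im_mul_I hX, hr,
        Complex.real_smul, smul_eq_mul]
      push_cast
      field_simp
      simp)
    refine ⟨(w, r), ?_⟩
    simp [hw]
    rw [sub_mul, smul_mul_assoc, smul_mul_assoc, one_mul, sub_add_cancel]
  · rw [nhds_prod_eq]
    exact (tendsto_fst.eventually hS).and (tendsto_snd.eventually
      (eventually_eq_zero_of_exp_mul_eq_one _ Fintype.card_ne_zero))
  · rintro ⟨w, θ⟩ ⟨hw, -⟩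
    refine mul_mem (exp_mem_unitary ?_) (hu hw)
    simp

end Controllability

end DegenerateSystem

end

theorem lemma1 (N : ℕ) (hN : 3 ≤ N) (E : ℕ → ℝ) (d : ℕ → ℕ → ℕ → ℝ)
    (hE : ∀ n, 1 ≤ n → n ≤ N - 1 → E n < E (n + 1))
    (hd : ∀ n, 2 ≤ n → n ≤ N - 1 → d n 1 1 * d n 2 2 ≠ d n 1 2 * d n 2 1)
    (hxy :
      (xOp N 1 1 2 1 ∈ dynamicalLieAlgebra N E d ∧ xOp N 1 1 2 2 ∈ dynamicalLieAlgebra N E d) ∨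
      (yOp N 1 1 2 1 ∈ dynamicalLieAlgebra N E d ∧ yOp N 1 1 2 2 ∈ dynamicalLieAlgebra N E d)) :
    specialUnitaryLieAlgebra (State N) ≤ dynamicalLieAlgebra N E d ∧
    ((freeHamiltonian N E).trace = 0 →
      dynamicalLieAlgebra N E d = specialUnitaryLieAlgebra (State N)) ∧
    ((freeHamiltonian N E).trace ≠ 0 →
      dynamicalLieAlgebra N E d = unitaryLieAlgebra (State N)) ∧
    CompletelyControllable (freeHamiltonian N E) (dipoleHamiltonian N d) ∧
    ((freeHamiltonian N E).trace ≠ 0 →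
      ∀ W ∈ Matrix.unitaryGroup (State N) ℂ,
        Reachable (freeHamiltonian N E) (dipoleHamiltonian N d) W) := by
  have hle := specialUnitary_le_dynamical hN hE hd hxy
  have h₀ := freeHamiltonian_conjTranspose (N := N) E
  have h₁ := dipoleHamiltonian_conjTranspose (N := N) d
  have htr₁ := dipoleHamiltonian_trace (N := N) d
  have hu (htr : (freeHamiltonian N E).trace ≠ 0) : ∀ W ∈ Matrix.unitaryGroup (State N) ℂ,
      Reachable (freeHamiltonian N E) (dipoleHamiltonian N d) W := fun W hW =>
    reachable_of_mem_evolutionSemigroup (mem_evolutionSemigroup_of_lieSpan_eq_unitary h₀ h₁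
      (lieSpan_eq_unitary h₀ h₁ htr hle) hW)
  refine ⟨hle, fun htr => lieSpan_eq_specialUnitary h₀ h₁ htr htr₁ hle,
    fun htr => lieSpan_eq_unitary h₀ h₁ htr hle, fun W hW => ?_, hu⟩
  by_cases htr : (freeHamiltonian N E).trace = 0
  · have : Nonempty (State N) :=
      ⟨⟨(1, 1), mem_labels.2 ⟨⟨le_rfl, by omega⟩, le_rfl, by simp [deg]⟩⟩⟩
    exact reachable_of_mem_evolutionSemigroup
      (mem_evolutionSemigroup_of_lieSpan_eq_specialUnitary h₀ h₁ htr htr₁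
        (lieSpan_eq_specialUnitary h₀ h₁ htr htr₁ hle) hW)
  · exact hu htr W (Matrix.mem_specialUnitaryGroup_iff.1 hW).1
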